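/- Let $\alpha>0$, $\alpha\neq1$, and let $\mu$ be a $\sigma$-finite measure on a measurable space $\mathbb X$. All probability measures $P,Q,R$ below are assumed absolutely continuous with respect to $\mu$, with densities $p,q,r\in L^\alpha(\mu)$ (that is, $\int p^\alpha\,d\mu<\infty$, etc.). With $\rho=\alpha^{-1}-1$, $f(u)=\operatorname{sgn}(\rho)(u^{1+\rho}-1)$ and escort densities $p'=p^\alpha/\int p^\alpha d\mu$, $q'=q^\alpha/\int q^\alpha d\mu$, the relative $\alpha$-entropy is $$\mathscr I_\alpha(P,Q)=\frac1\rho\log\Big[\operatorname{sgn}(\rho)\int q' f(p'/q')\,d\mu+1\Big]\in[0,\infty],$$ where $0f(0/0)=0$ and, for $a>0$, $0f(a/0)=\infty$ if $\rho>0$ and $0f(a/0)=0$ if $\rho<0$. A forward $\mathscr I_\alpha$-projection of $R$ on a set $\mathbb E$ of probability measures containing some $P$ with $\mathscr I_\alpha(P,R)<\infty$ is a $Q\in\mathbb E$ with $\mathscr I_\alpha(Q,R)=\inf_{P\in\mathbb E}\mathscr I_\alpha(P,R)$. Let $f_\gamma:\mathbb X\to\mathbb R$ ($\gamma\in\Gamma$,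 an arbitrary index set) be measurable functions, let $\mathbb L=\{P:\ f_\gamma\in L^1(P),\ \int f_\gamma\,dP=0\ \text{for all }\gamma\in\Gamma\}$, and let $R$ have density $r$. For $Q\in\mathbb L$, a real number $c$, a function $g:\mathbb X\to\mathbb R$ and a measurable set $N\subseteq\mathbb X$, consider the conditions, where powers are taken in $[0,\infty]$ (so $0^{\alpha-1}=\infty$ if $\alpha<1$): 1. for $\mu$-almost every $x$: $q(x)^{\alpha-1}=c\,r(x)^{\alpha-1}+g(x)$ if $x\notin N$, and $q(x)=0$ if $x\in N$; 2. for every $P\in\mathbb L$ with $\mathscr I_\alpha(P,R)<\infty$: if $\alpha<1$, then $P(N)=0$; if $\alpha>1$, then $g$ is $P$-integrable on $\mathbb X\setminus N$ and $c\int_N r^{\alpha-1}\,dP\le\int_{\mathbb X\setminus N}g\,dP$. (a) If $Q$ is a forward $\mathscr I_\alpha$-projection of $R$ on $\mathbb L$, then there are $c$, $g$, $N$ satisfying 1 and 2 such that $0<\int q\,r^{\alpha-1}\,d\mu<\infty$, $$c=\frac{\int q^\alpha\,d\mu}{\int q\,r^{\alpha-1}\,d\mu},$$ and $g$ belongs to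 the $L^1(Q)$-closure of the linear span of $\{f_\gamma\}_{\gamma\in\Gamma}$. (b) Conversely, if $Q\in\mathbb L$ satisfies 1 and 2 for some real $c$, some $g$ in the linear span of $\{f_\gamma\}_{\gamma\in\Gamma}$ and some measurable $N$, then $Q$ is the unique forward $\mathscr I_\alpha$-projection of $R$ on $\mathbb L$, and for every $P\in\mathbb L$ with $\mathscr I_\alpha(P,R)<\infty$, $$\mathscr I_\alpha(P,R)\ \ge\ \mathscr I_\alpha(P,Q)+\mathscr I_\alpha(Q,R),$$ with equality when $\alpha<1$. -/

import Mathlib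

open MeasureTheory
open scoped ENNReal

noncomputable section

namespace RelAlpha

variable {X : Type*} [MeasurableSpace X]

/-- The standing assumptions on a measure: it is a probability measure, dominated by `μ`, whose
`μ`-density belongs to `L^α(μ)`. -/
structure IsAdmissible (α : ℝ) (μ P : Measure X) : Prop where
  isProb : IsProbabilityMeasure P
  absCont : P ≪ μ
  memLalpha : ∫⁻ x, (P.rnDeriv μ x) ^ α ∂μ < ⊤

/-- The density `p' = p ^ α / ∫ p ^ α dμ` of the escort measure. -/
def escort (α : ℝ) (μ P : Measure X) (x : X) : ℝ≥0∞ :=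
  (P.rnDeriv μ x) ^ α / ∫⁻ y, (P.rnDeriv μ y) ^ α ∂μ

/-- `f(u) = sgn(ρ) (u ^ (1 + ρ) - 1)`. -/
def fFun (ρ u : ℝ) : ℝ := Real.sign ρ * (u ^ (1 + ρ) - 1)

/-- The integrand `b f(a / b)`, with `0 f(0 / 0) = 0` and, for `a > 0`,
`0 f(a / 0) = ∞` if `ρ > 0` and `0 f(a / 0) = 0` if `ρ < 0`. -/
def fDivIntegrand (ρ : ℝ) (a b : ℝ≥0∞) : EReal :=
  if b = 0 then (if a = 0 then 0 else if 0 < ρ then ⊤ else 0)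
  else ((b.toReal * fFun ρ (a.toReal / b.toReal) : ℝ) : EReal)

/-- The `f`-divergence `∫ q f(p / q) dμ` of two densities, as an extended real: the integral of
the positive part minus the integral of the negative part (the latter is finite for all
probability densities). -/
def fDiv (ρ : ℝ) (μ : Measure X) (p q : X → ℝ≥0∞) : EReal :=
  ((∫⁻ x, (fDivIntegrand ρ (p x) (q x)).toENNReal ∂μ : ℝ≥0∞) : EReal)
    - ((∫⁻ x, (-fDivIntegrand ρ (p x) (q x)).toENNReal ∂μ : ℝ≥0∞) : EReal)

/-- The relative `α`-entropy `(1 / ρ) log (sgn(ρ) I_f(P', Q') + 1)` with `ρ = 1 / α - 1`,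
where `log 0 = -∞` and `log ∞ = ∞`. -/
def relEntropy (α : ℝ) (μ P Q : Measure X) : EReal :=
  (((α⁻¹ - 1)⁻¹ : ℝ) : EReal) *
    ENNReal.log
      (((Real.sign (α⁻¹ - 1) : ℝ) : EReal) * fDiv (α⁻¹ - 1) μ (escort α μ P) (escort α μ Q)
        + 1).toENNReal

/-- `Q` is a forward projection of `R` on the set `E` of measures. -/
structure IsForwardProjection (α : ℝ) (μ : Measure X) (E : Set (Measure X)) (R Q : Measure X) :
    Prop where
  exists_finite : ∃ P ∈ E, relEntropy α μ P R < ⊤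
  mem : Q ∈ E
  eq_iInf : relEntropy α μ Q R = ⨅ P ∈ E, relEntropy α μ P R

/-- The linear family `{P : ∫ f_γ dP = 0 for all γ}` of (admissible) probability measures. -/
def linearFamily {Γ : Type*} (α : ℝ) (μ : Measure X) (f : Γ → X → ℝ) : Set (Measure X) :=
  {P | IsAdmissible α μ P ∧ ∀ γ, Integrable (f γ) P ∧ ∫ x, f γ x ∂P = 0}

/-- The power-law form: `q ^ (α - 1) = c r ^ (α - 1) + g` off `N` and `q = 0` on `N`, for
`μ`-almost every point since densities are only defined up to null sets. Both powers are taken in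
`[0, ∞]`, so that `0 ^ (α - 1) = ∞` if `α < 1`. -/
def HasPowerLawForm (α : ℝ) (μ Q R : Measure X) (c : ℝ) (g : X → ℝ) (N : Set X) : Prop :=
  ∀ᵐ x ∂μ,
    (x ∉ N → (((Q.rnDeriv μ x) ^ (α - 1) : ℝ≥0∞) : EReal)
      = (c : EReal) * (((R.rnDeriv μ x) ^ (α - 1) : ℝ≥0∞) : EReal) + (g x : EReal)) ∧
    (x ∈ N → Q.rnDeriv μ x = 0)

/-- The side condition on `N`: for every `P` in `E` at finite relative `α`-entropy from `R`,
`P(N) = 0` if `α < 1`, and `c ∫_N r ^ (α - 1) dP ≤ ∫_{X \ N} g dP` if `α > 1` (the last integral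
being well defined and finite). -/
def SideCondition (α : ℝ) (μ : Measure X) (E : Set (Measure X)) (R : Measure X)
    (c : ℝ) (g : X → ℝ) (N : Set X) : Prop :=
  ∀ P ∈ E, relEntropy α μ P R < ⊤ →
    (α < 1 → P N = 0) ∧
    (1 < α → IntegrableOn g Nᶜ P ∧
      (c : EReal) * ((∫⁻ x in N, (R.rnDeriv μ x) ^ (α - 1) ∂P : ℝ≥0∞) : EReal)
        ≤ ((∫ x in Nᶜ, g x ∂P : ℝ) : EReal))

/-- `g` belongs to the `L¹(Q)`-closure of the linear span of the functions `f γ`. -/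
def InL1ClosureSpan {Γ : Type*} (Q : Measure X) (f : Γ → X → ℝ) (g : X → ℝ) : Prop :=
  MemLp g 1 Q ∧
    ∀ ε : ℝ≥0∞, 0 < ε → ∃ h ∈ Submodule.span ℝ (Set.range f), eLpNorm (g - h) 1 Q < ε

end RelAlpha

end

/- For densities `p`, `q` put `‖p‖ = (∫ p ^ α dμ) ^ (1 / α)` and `⟨p, q⟩ = ∫ p q ^ (α - 1) dμ`. The
relative `α`-entropy is `(1 / ρ) log (⟨p, q⟩ / (‖p‖ ‖q‖ ^ (α - 1)))`, where the argument of the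
logarithm is `≥ 1` if `α < 1` and `≤ 1` if `α > 1` by Hölder's inequality. Integrating a power law
for `q` against `P` gives `⟨p, q⟩` in terms of `⟨p, r⟩`, which is the Pythagorean relation and makes
`Q` the unique projection.

Conversely, the entropy relative to `R` is unchanged when `p` is multiplied by a constant, so a
projection `Q` can be compared with the unnormalised measures of density `m = q + t p`. Expanding
`⟨m, m⟩ = ⟨q, m⟩ + t ⟨p, m⟩` and applying Hölder's inequality to `⟨q, m⟩`, minimality bounds
`⟨p, m⟩` by `⟨p, r⟩` without differentiating the entropy, and `t → 0` yields `∫ g dP ≤ 0` (`α < 1`)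
or `∫ g dP ≥ 0` (`α > 1`) for `g = q ^ (α - 1) - c r ^ (α - 1)`. For `P = (1 ± k) Q` with `k` small
and `∫ k dQ = ∫ k f γ dQ = 0` for all `γ`, both signs give `∫ k g dQ = 0`, and by Hahn–Banach `g` is
in the closed span. -/

noncomputable section

open Filter Topology
open scoped NNReal

namespace RelAlpha

variable {X : Type*} [MeasurableSpace X] {μ : Measure X}

section HellingerIntegral

variable {θ : ℝ}

/-- The Hellinger integral `∫ a ^ θ b ^ (1 - θ) dμ` of two densities. For the exponent `θ = 1 / α`
and the escort densities it is the argument of the logarithm in the relative `α`-entropy. -/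
def hellingerIntegral (θ : ℝ) (μ : Measure X) (a b : X → ℝ≥0∞) : ℝ≥0∞ :=
  ∫⁻ x, a x ^ θ * b x ^ (1 - θ) ∂μ

lemma sign_mul_mul_fFun (hθ1 : θ ≠ 1) {a b : ℝ} (ha : 0 ≤ a) (hb : 0 < b) :
    Real.sign (θ - 1) * (b * fFun (θ - 1) (a / b)) = a ^ θ * b ^ (1 - θ) - b := by
  have hsign : Real.sign (θ - 1) * Real.sign (θ - 1) = 1 := by
    rcases Real.sign_apply_eq_of_ne_zero _ (sub_ne_zero.2 hθ1) with h | h <;> simp [h]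
  calc Real.sign (θ - 1) * (b * fFun (θ - 1) (a / b))
      = Real.sign (θ - 1) * Real.sign (θ - 1) * (b * (a / b) ^ θ - b) := by
        rw [fFun, add_sub_cancel]; ring
    _ = a ^ θ * b ^ (1 - θ) - b := by
        rw [hsign, Real.div_rpow ha hb.le, Real.rpow_sub hb, Real.rpow_one]; ring

lemma sign_mul_fDivIntegrand (hθ : 0 < θ) (hθ1 : θ ≠ 1) {a b : ℝ≥0∞} (ha : a ≠ ⊤) (hb : b ≠ ⊤) :
    (Real.sign (θ - 1) : EReal) * fDivIntegrand (θ - 1) a b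
      = ((a ^ θ * b ^ (1 - θ) : ℝ≥0∞) : EReal) - (b : EReal) := by
  rcases eq_or_ne b 0 with rfl | hb0
  · rcases eq_or_ne a 0 with rfl | ha0
    · simp [fDivIntegrand, hθ]
    · rcases hθ1.lt_or_gt with h | h
      · simp [fDivIntegrand, ha0, not_lt.2 h.le, h]
      · have hpow : a ^ θ ≠ 0 := by simp [ha0, ha]
        simp [fDivIntegrand, ha0, h, Real.sign_of_pos, ENNReal.zero_rpow_of_neg, hpow]
  · lift a to NNReal using ha
    lift b to NNReal using hb
    have hb0' : b ≠ 0 := by simpa using hb0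
    have hreal := sign_mul_mul_fFun hθ1 a.coe_nonneg (NNReal.coe_pos.2 (pos_iff_ne_zero.2 hb0'))
    rw [fDivIntegrand, if_neg hb0, ← EReal.coe_mul, ENNReal.coe_toReal, ENNReal.coe_toReal, hreal,
      ← ENNReal.coe_rpow_of_nonneg _ hθ.le, ← ENNReal.coe_rpow_of_ne_zero hb0', ← ENNReal.coe_mul,
      EReal.coe_sub]
    rfl

lemma coe_sub_add_coe_eq {s t b k : ℝ≥0∞} (hs : s ≠ ⊤) (h : t + b = s + k) :
    (t : EReal) - (s : EReal) + b = (k : EReal) := by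
  have hcast : (t : EReal) + b = k + s := by
    rw [add_comm (k : EReal)]
    exact_mod_cast congrArg ENNReal.toEReal h
  lift s to NNReal using hs
  rw [sub_eq_add_neg, add_right_comm, hcast, ← sub_eq_add_neg]
  exact EReal.add_sub_cancel_right

lemma toENNReal_neg_of_eq_coe_sub_coe {y : EReal} {k b : ℝ≥0∞} (hb : b ≠ ⊤)
    (hy : y = (k : EReal) - b) : (-y).toENNReal = b - k := by
  rw [hy, EReal.neg_sub (.inl (EReal.coe_ennreal_ne_bot k))
      (.inr (mt EReal.coe_ennreal_eq_top_iff.1 hb)), add_comm, ← sub_eq_add_neg,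
    EReal.toENNReal_sub (EReal.coe_ennreal_nonneg k), EReal.toENNReal_coe, EReal.toENNReal_coe]

lemma lintegral_toENNReal_neg_ne_top {F : X → EReal} {k b : X → ℝ≥0∞} (hb : Measurable b)
    (hbt : ∫⁻ x, b x ∂μ ≠ ⊤) (hF : ∀ᵐ x ∂μ, F x = (k x : EReal) - b x) :
    ∫⁻ x, (-F x).toENNReal ∂μ ≠ ⊤ := by
  refine ne_top_of_le_ne_top hbt (lintegral_mono_ae ?_)
  filter_upwards [hF, ae_lt_top hb hbt] with x hx hbx
  exact (toENNReal_neg_of_eq_coe_sub_coe hbx.ne hx).trans_le tsub_le_self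

lemma lintegral_toENNReal_sub_lintegral_toENNReal_neg_add {F : X → EReal} {k b : X → ℝ≥0∞}
    (hk : Measurable k) (hb : Measurable b) (hbt : ∫⁻ x, b x ∂μ ≠ ⊤)
    (hF : ∀ᵐ x ∂μ, F x = (k x : EReal) - b x) :
    ((∫⁻ x, (F x).toENNReal ∂μ : ℝ≥0∞) : EReal) - (∫⁻ x, (-F x).toENNReal ∂μ : ℝ≥0∞)
      + (∫⁻ x, b x ∂μ : ℝ≥0∞) = (∫⁻ x, k x ∂μ : ℝ≥0∞) := by
  have hpos : ∫⁻ x, (F x).toENNReal ∂μ = ∫⁻ x, k x - b x ∂μ :=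
    lintegral_congr_ae <| hF.mono fun x hx => by
      simp only [hx, EReal.toENNReal_sub (EReal.coe_ennreal_nonneg _), EReal.toENNReal_coe]
  have hneg : ∫⁻ x, (-F x).toENNReal ∂μ = ∫⁻ x, b x - k x ∂μ := by
    refine lintegral_congr_ae ?_
    filter_upwards [hF, ae_lt_top hb hbt] with x hx hbx
      using toENNReal_neg_of_eq_coe_sub_coe hbx.ne hx
  refine coe_sub_add_coe_eq (lintegral_toENNReal_neg_ne_top hb hbt hF) ?_
  rw [hpos, hneg, ← lintegral_add_right _ hb, ← lintegral_add_right _ hk]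
  simp only [tsub_add_eq_max, max_comm]

lemma sign_mul_fDiv_add_lintegral (hθ : 0 < θ) (hθ1 : θ ≠ 1) {a b : X → ℝ≥0∞}
    (ham : Measurable a) (hbm : Measurable b) (ha : ∀ᵐ x ∂μ, a x ≠ ⊤) (hb : ∫⁻ x, b x ∂μ ≠ ⊤) :
    (Real.sign (θ - 1) : EReal) * fDiv (θ - 1) μ a b + (∫⁻ x, b x ∂μ : ℝ≥0∞)
      = (hellingerIntegral θ μ a b : EReal) := by
  have hk : Measurable fun x => a x ^ θ * b x ^ (1 - θ) := by fun_prop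
  have hF : ∀ᵐ x ∂μ, (Real.sign (θ - 1) : EReal) * fDivIntegrand (θ - 1) (a x) (b x)
      = ((a x ^ θ * b x ^ (1 - θ) : ℝ≥0∞) : EReal) - b x := by
    filter_upwards [ha, ae_lt_top hbm hb] with x hax hbx
      using sign_mul_fDivIntegrand hθ hθ1 hax hbx.ne
  rw [hellingerIntegral, ← lintegral_toENNReal_sub_lintegral_toENNReal_neg_add hk hbm hb hF]
  congr 1
  have hfin := lintegral_toENNReal_neg_ne_top hbm hb hF
  rcases hθ1.lt_or_gt with h | h
  · simp only [Real.sign_of_neg (sub_neg.2 h), EReal.coe_neg, EReal.coe_one, neg_mul, one_mul,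
      neg_neg] at hfin ⊢
    rw [fDiv, EReal.neg_sub (.inl (EReal.coe_ennreal_ne_bot _))
      (.inl (mt EReal.coe_ennreal_eq_top_iff.1 hfin)), add_comm, ← sub_eq_add_neg]
  · simp only [Real.sign_of_pos (sub_pos.2 h), EReal.coe_one, one_mul, fDiv]

lemma rpow_mul_rpow_one_sub (hθ : 0 < θ) {a b : NNReal} (hb : 0 < b) :
    ((a : ℝ≥0∞) ^ θ * (b : ℝ≥0∞) ^ (1 - θ)) = ((b * (a / b) ^ θ : NNReal) : ℝ≥0∞) := by
  rw [← ENNReal.coe_rpow_of_nonneg _ hθ.le, ← ENNReal.coe_rpow_of_ne_zero hb.ne', ← ENNReal.coe_mul,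
    NNReal.rpow_sub hb.ne', NNReal.div_rpow, NNReal.rpow_one]
  ring_nf

lemma rpow_mul_rpow_add_lt (hθ : 0 < θ) (hθ1 : θ < 1) {a b : ℝ≥0∞} (ha : a ≠ ⊤) (hb : b ≠ ⊤)
    (hab : a ≠ b) :
    a ^ θ * b ^ (1 - θ) + ENNReal.ofReal θ * b < b + ENNReal.ofReal θ * a := by
  rcases eq_or_ne b 0 with rfl | hb0
  · simpa [hθ1, hθ, pos_iff_ne_zero] using hab
  lift a to NNReal using ha
  lift b to NNReal using hb
  have hbpos : 0 < b := by simpa [pos_iff_ne_zero] using hb0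
  have hbernoulli : ((a : ℝ) / b) ^ θ < 1 + θ * (a / b - 1) := by
    simpa using rpow_one_add_lt_one_add_mul_self (s := (a : ℝ) / b - 1)
      (by have : (0 : ℝ) ≤ a / b := by positivity
          linarith)
      (by rw [sub_ne_zero, Ne, div_eq_one_iff_eq (by positivity)]; exact_mod_cast hab) hθ hθ1
  rw [rpow_mul_rpow_one_sub hθ hbpos, ENNReal.ofReal]
  norm_cast
  rw [← NNReal.coe_lt_coe]
  push_cast [Real.coe_toNNReal θ hθ.le]
  have hb' : (0 : ℝ) < b := hbpos
  have := mul_lt_mul_of_pos_left hbernoulli hb'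
  field_simp at this ⊢
  linarith

lemma lt_rpow_mul_rpow_add (hθ : 1 < θ) {a b : ℝ≥0∞} (ha : a ≠ ⊤) (hb : b ≠ ⊤) (hab : a ≠ b) :
    b + ENNReal.ofReal θ * a < a ^ θ * b ^ (1 - θ) + ENNReal.ofReal θ * b := by
  have hθ0 : 0 < θ := zero_lt_one.trans hθ
  rcases eq_or_ne b 0 with rfl | hb0
  · have hpow : a ^ θ ≠ 0 := by simp [hab, ha]
    simpa [ENNReal.zero_rpow_of_neg (sub_neg.2 hθ), hpow] using
      ENNReal.mul_lt_top ENNReal.ofReal_lt_top ha.lt_top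
  lift a to NNReal using ha
  lift b to NNReal using hb
  have hbpos : 0 < b := by simpa [pos_iff_ne_zero] using hb0
  have hbernoulli : 1 + θ * ((a : ℝ) / b - 1) < (a / b) ^ θ := by
    simpa using one_add_mul_self_lt_rpow_one_add (s := (a : ℝ) / b - 1)
      (by have : (0 : ℝ) ≤ a / b := by positivity
          linarith)
      (by rw [sub_ne_zero, Ne, div_eq_one_iff_eq (by positivity)]; exact_mod_cast hab) hθ
  rw [rpow_mul_rpow_one_sub hθ0 hbpos, ENNReal.ofReal]
  norm_cast
  rw [← NNReal.coe_lt_coe]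
  push_cast [Real.coe_toNNReal θ hθ0.le]
  have hb' : (0 : ℝ) < b := hbpos
  have := mul_lt_mul_of_pos_left hbernoulli hb'
  field_simp at this ⊢
  linarith

lemma rpow_mul_rpow_self {a : ℝ≥0∞} (ha : a ≠ ⊤) : a ^ θ * a ^ (1 - θ) = a := by
  rw [← ENNReal.rpow_add_of_add_pos ha _ _ (by linarith), add_sub_cancel, ENNReal.rpow_one]

lemma ae_rpow_mul_rpow_add_le (hθ : 0 < θ) (hθ1 : θ < 1) {a b : X → ℝ≥0∞}
    (ha : ∀ᵐ x ∂μ, a x ≠ ⊤) (hb : ∀ᵐ x ∂μ, b x ≠ ⊤) :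
    (fun x => a x ^ θ * b x ^ (1 - θ) + ENNReal.ofReal θ * b x) ≤ᵐ[μ]
      fun x => b x + ENNReal.ofReal θ * a x := by
  filter_upwards [ha, hb] with x hax hbx
  rcases eq_or_ne (a x) (b x) with h | h
  · simp only [h, rpow_mul_rpow_self hbx, le_refl]
  · exact (rpow_mul_rpow_add_lt hθ hθ1 hax hbx h).le

lemma ae_le_rpow_mul_rpow_add (hθ : 1 < θ) {a b : X → ℝ≥0∞}
    (ha : ∀ᵐ x ∂μ, a x ≠ ⊤) (hb : ∀ᵐ x ∂μ, b x ≠ ⊤) :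
    (fun x => b x + ENNReal.ofReal θ * a x) ≤ᵐ[μ]
      fun x => a x ^ θ * b x ^ (1 - θ) + ENNReal.ofReal θ * b x := by
  filter_upwards [ha, hb] with x hax hbx
  rcases eq_or_ne (a x) (b x) with h | h
  · simp only [h, rpow_mul_rpow_self hbx, le_refl]
  · exact (lt_rpow_mul_rpow_add hθ hax hbx h).le

variable {a b : X → ℝ≥0∞}

lemma lintegral_rpow_mul_rpow_add (hbm : Measurable b) (hb : ∫⁻ x, b x ∂μ = 1) :
    ∫⁻ x, (a x ^ θ * b x ^ (1 - θ) + ENNReal.ofReal θ * b x) ∂μ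
      = hellingerIntegral θ μ a b + ENNReal.ofReal θ := by
  rw [lintegral_add_right _ (hbm.const_mul _), lintegral_const_mul _ hbm, hb, mul_one,
    hellingerIntegral]

lemma lintegral_add_const_mul (ham : Measurable a) (hbm : Measurable b)
    (ha : ∫⁻ x, a x ∂μ = 1) (hb : ∫⁻ x, b x ∂μ = 1) (c : ℝ≥0∞) :
    ∫⁻ x, (b x + c * a x) ∂μ = 1 + c := by
  rw [lintegral_add_left hbm, lintegral_const_mul _ ham, ha, hb, mul_one]

lemma ae_ne_top_of_lintegral_eq_one (ham : Measurable a) (ha : ∫⁻ x, a x ∂μ = 1) :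
    ∀ᵐ x ∂μ, a x ≠ ⊤ :=
  (ae_lt_top ham (ha ▸ ENNReal.one_ne_top)).mono fun _ => LT.lt.ne

lemma hellingerIntegral_le_one (hθ : 0 < θ) (hθ1 : θ < 1) (ham : Measurable a)
    (hbm : Measurable b) (ha : ∫⁻ x, a x ∂μ = 1) (hb : ∫⁻ x, b x ∂μ = 1) :
    hellingerIntegral θ μ a b ≤ 1 := by
  have h := lintegral_mono_ae <| ae_rpow_mul_rpow_add_le hθ hθ1
    (ae_ne_top_of_lintegral_eq_one ham ha) (ae_ne_top_of_lintegral_eq_one hbm hb)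
  rwa [lintegral_rpow_mul_rpow_add hbm hb, lintegral_add_const_mul ham hbm ha hb,
    ENNReal.add_le_add_iff_right ENNReal.ofReal_ne_top] at h

lemma one_le_hellingerIntegral (hθ : 1 < θ) (ham : Measurable a)
    (hbm : Measurable b) (ha : ∫⁻ x, a x ∂μ = 1) (hb : ∫⁻ x, b x ∂μ = 1) :
    1 ≤ hellingerIntegral θ μ a b := by
  have h := lintegral_mono_ae <| ae_le_rpow_mul_rpow_add hθ
    (ae_ne_top_of_lintegral_eq_one ham ha) (ae_ne_top_of_lintegral_eq_one hbm hb)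
  rwa [lintegral_rpow_mul_rpow_add hbm hb, lintegral_add_const_mul ham hbm ha hb,
    ENNReal.add_le_add_iff_right ENNReal.ofReal_ne_top] at h

lemma ae_eq_of_hellingerIntegral_eq_one (hθ : 0 < θ) (hθ1 : θ ≠ 1) (ham : Measurable a)
    (hbm : Measurable b) (ha : ∫⁻ x, a x ∂μ = 1) (hb : ∫⁻ x, b x ∂μ = 1)
    (h : hellingerIntegral θ μ a b = 1) : a =ᵐ[μ] b := by
  have hat := ae_ne_top_of_lintegral_eq_one ham ha
  have hbt := ae_ne_top_of_lintegral_eq_one hbm hb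
  have hleft := lintegral_rpow_mul_rpow_add (θ := θ) (a := a) hbm hb
  have hright := lintegral_add_const_mul ham hbm ha hb (ENNReal.ofReal θ)
  rw [h, ← hright] at hleft
  have hfin : 1 + ENNReal.ofReal θ ≠ ⊤ := by finiteness
  rcases hθ1.lt_or_gt with hlt | hgt
  · have heq := ae_eq_of_ae_le_of_lintegral_le (ae_rpow_mul_rpow_add_le hθ hlt hat hbt)
      (by rwa [hleft, hright]) (by fun_prop) hleft.ge
    filter_upwards [heq, hat, hbt] with x hx hax hbx
    by_contra hne
    exact (rpow_mul_rpow_add_lt hθ hlt hax hbx hne).ne hx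
  · have heq := ae_eq_of_ae_le_of_lintegral_le (ae_le_rpow_mul_rpow_add hgt hat hbt)
      (by rwa [hright]) (by fun_prop) hleft.le
    filter_upwards [heq, hat, hbt] with x hx hax hbx
    by_contra hne
    exact (lt_rpow_mul_rpow_add hgt hax hbx hne).ne hx

end HellingerIntegral

section CrossIntegral

variable {α : ℝ} {P Q R : Measure X}

/-- The `L^α(μ)`-norm (a quasinorm if `α < 1`) of the `μ`-density of `P`. -/
def densityNorm (α : ℝ) (μ P : Measure X) : ℝ≥0∞ :=
  (∫⁻ x, (P.rnDeriv μ x) ^ α ∂μ) ^ α⁻¹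

/-- The cross integral `∫ p q ^ (α - 1) dμ`, written as an integral with respect to `P` so that it
is visibly linear in `P`. -/
def crossIntegral (α : ℝ) (μ P Q : Measure X) : ℝ≥0∞ :=
  ∫⁻ x, (Q.rnDeriv μ x) ^ (α - 1) ∂P

/-- The cross integral of the densities of `P` and `Q` divided by their norms. Hölder's inequality
compares it with `1`, and the relative `α`-entropy is a multiple of its logarithm. -/
def normalizedCrossIntegral (α : ℝ) (μ P Q : Measure X) : ℝ≥0∞ :=
  crossIntegral α μ P Q / (densityNorm α μ P * densityNorm α μ Q ^ (α - 1))

/-- `P` is a nonzero finite measure, dominated by `μ`, whose `μ`-density belongs to `L^α(μ)`.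
Contrary to `IsAdmissible`, this does not ask for total mass one, which makes the class stable
under sums and multiples. -/
structure HasLpDensity (α : ℝ) (μ P : Measure X) : Prop where
  isFinite : IsFiniteMeasure P
  ne_zero : P ≠ 0
  absCont : P ≪ μ
  lintegral_lt_top : ∫⁻ x, (P.rnDeriv μ x) ^ α ∂μ < ⊤

lemma IsAdmissible.hasLpDensity (hP : IsAdmissible α μ P) : HasLpDensity α μ P := by
  have := hP.isProb
  exact ⟨inferInstance, IsProbabilityMeasure.ne_zero P, hP.absCont, hP.memLalpha⟩

lemma densityNorm_rpow (hα : α ≠ 0) :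
    densityNorm α μ P ^ α = ∫⁻ x, (P.rnDeriv μ x) ^ α ∂μ := by
  rw [densityNorm, ENNReal.rpow_inv_rpow hα]

lemma HasLpDensity.densityNorm_ne_top (hα : 0 < α) (hP : HasLpDensity α μ P) :
    densityNorm α μ P ≠ ⊤ :=
  ENNReal.rpow_ne_top_of_nonneg (inv_nonneg.2 hα.le) hP.lintegral_lt_top.ne

lemma HasLpDensity.ae_rnDeriv_ne_top (hP : HasLpDensity α μ P) :
    ∀ᵐ x ∂μ, P.rnDeriv μ x ≠ ⊤ :=
  have := hP.isFinite
  Measure.rnDeriv_ne_top P μ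

lemma mul_rpow_sub_one (hα : 0 < α) {a : ℝ≥0∞} (ha : a ≠ ⊤) : a * a ^ (α - 1) = a ^ α := by
  nth_rw 1 [← ENNReal.rpow_one a]
  rw [← ENNReal.rpow_add_of_add_pos ha _ _ (by linarith), add_sub_cancel]

lemma densityNorm_mul_rpow_sub_one (hα : 0 < α) (hP : HasLpDensity α μ P) :
    densityNorm α μ P * densityNorm α μ P ^ (α - 1) = densityNorm α μ P ^ α :=
  mul_rpow_sub_one hα (hP.densityNorm_ne_top hα)

lemma div_rpow_of_ne_zero_of_ne_top (x : ℝ≥0∞) {y : ℝ≥0∞} (hy : y ≠ 0) (hy' : y ≠ ⊤) (z : ℝ) :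
    (x / y) ^ z = x ^ z / y ^ z := by
  rw [div_eq_mul_inv, ENNReal.mul_rpow_eq_ite, if_neg (by simp [hy, hy']), ENNReal.inv_rpow,
    div_eq_mul_inv]

lemma measurable_escort : Measurable (escort α μ P) := by
  unfold escort; fun_prop

lemma escort_rpow_inv (hα : 0 < α) (x : X) :
    escort α μ P x ^ α⁻¹ = P.rnDeriv μ x / densityNorm α μ P := by
  rw [escort, ENNReal.div_rpow_of_nonneg _ _ (inv_nonneg.2 hα.le), ENNReal.rpow_rpow_inv hα.ne',
    densityNorm]

variable [SigmaFinite μ]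

lemma HasLpDensity.ae_self_rnDeriv_ne_zero (hP : HasLpDensity α μ P) :
    ∀ᵐ x ∂P, P.rnDeriv μ x ≠ 0 :=
  have := hP.isFinite
  (Measure.rnDeriv_pos hP.absCont).mono fun _ => ne_of_gt

lemma HasLpDensity.densityNorm_ne_zero (hα : 0 < α) (hP : HasLpDensity α μ P) :
    densityNorm α μ P ≠ 0 := by
  have := hP.isFinite
  rw [densityNorm, Ne, ENNReal.rpow_eq_zero_iff_of_pos (inv_pos.2 hα),
    lintegral_eq_zero_iff (by fun_prop)]
  refine fun h => hP.ne_zero (Measure.eq_zero_of_absolutelyContinuous_of_mutuallySingular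
    hP.absCont ((Measure.rnDeriv_eq_zero P μ).1 ?_))
  exact h.mono fun x hx => (ENNReal.rpow_eq_zero_iff_of_pos hα).1 hx

lemma crossIntegral_eq_lintegral_mul (hP : HasLpDensity α μ P) :
    crossIntegral α μ P Q = ∫⁻ x, P.rnDeriv μ x * (Q.rnDeriv μ x) ^ (α - 1) ∂μ := by
  have := hP.isFinite
  exact (lintegral_rnDeriv_mul hP.absCont (by fun_prop)).symm

lemma crossIntegral_self (hα : 0 < α) (hP : HasLpDensity α μ P) :
    crossIntegral α μ P P = densityNorm α μ P ^ α := by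
  rw [crossIntegral_eq_lintegral_mul hP, densityNorm_rpow hα.ne']
  exact lintegral_congr_ae (hP.ae_rnDeriv_ne_top.mono fun x hx => mul_rpow_sub_one hα hx)

lemma escort_rpow_one_sub_inv (hα : 0 < α) (hP : HasLpDensity α μ P) (x : X) :
    escort α μ P x ^ (1 - α⁻¹) = (P.rnDeriv μ x) ^ (α - 1) / densityNorm α μ P ^ (α - 1) := by
  rw [← div_rpow_of_ne_zero_of_ne_top _ (hP.densityNorm_ne_zero hα) (hP.densityNorm_ne_top hα),
    ← escort_rpow_inv hα, ← ENNReal.rpow_mul]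
  congr 1
  field_simp

lemma lintegral_escort (hα : 0 < α) (hP : HasLpDensity α μ P) : ∫⁻ x, escort α μ P x ∂μ = 1 := by
  have hne : ∫⁻ x, (P.rnDeriv μ x) ^ α ∂μ ≠ 0 := by
    simpa [densityNorm_rpow hα.ne'] using
      (ENNReal.rpow_pos (pos_iff_ne_zero.2 (hP.densityNorm_ne_zero hα))
        (hP.densityNorm_ne_top hα) (p := α)).ne'
  simp only [escort, div_eq_mul_inv]
  rw [lintegral_mul_const _ (by fun_prop), ENNReal.mul_inv_cancel hne hP.lintegral_lt_top.ne]

lemma hellingerIntegral_escort (hα : 0 < α) (hP : HasLpDensity α μ P) (hQ : HasLpDensity α μ Q) :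
    hellingerIntegral α⁻¹ μ (escort α μ P) (escort α μ Q) = normalizedCrossIntegral α μ P Q := by
  have hP0 := hP.densityNorm_ne_zero hα
  have hPt := hP.densityNorm_ne_top hα
  calc ∫⁻ x, escort α μ P x ^ α⁻¹ * escort α μ Q x ^ (1 - α⁻¹) ∂μ
      = ∫⁻ x, P.rnDeriv μ x * (Q.rnDeriv μ x) ^ (α - 1)
          * (densityNorm α μ P * densityNorm α μ Q ^ (α - 1))⁻¹ ∂μ := by
        refine lintegral_congr fun x => ?_
        rw [escort_rpow_inv hα, escort_rpow_one_sub_inv hα hQ, div_eq_mul_inv, div_eq_mul_inv,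
          ENNReal.mul_inv (.inl hP0) (.inl hPt), mul_mul_mul_comm]
    _ = normalizedCrossIntegral α μ P Q := by
        rw [lintegral_mul_const _ (by fun_prop), ← crossIntegral_eq_lintegral_mul hP,
          ← div_eq_mul_inv, normalizedCrossIntegral]

lemma one_le_normalizedCrossIntegral (hα : 0 < α) (hα1 : α < 1) (hP : HasLpDensity α μ P)
    (hQ : HasLpDensity α μ Q) : 1 ≤ normalizedCrossIntegral α μ P Q := by
  rw [← hellingerIntegral_escort hα hP hQ]
  exact one_le_hellingerIntegral ((one_lt_inv₀ hα).2 hα1) measurable_escort measurable_escort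
    (lintegral_escort hα hP) (lintegral_escort hα hQ)

lemma normalizedCrossIntegral_le_one (hα1 : 1 < α) (hP : HasLpDensity α μ P)
    (hQ : HasLpDensity α μ Q) : normalizedCrossIntegral α μ P Q ≤ 1 := by
  have hα : 0 < α := zero_lt_one.trans hα1
  rw [← hellingerIntegral_escort hα hP hQ]
  exact hellingerIntegral_le_one (inv_pos.2 hα) (inv_lt_one_of_one_lt₀ hα1) measurable_escort
    measurable_escort (lintegral_escort hα hP) (lintegral_escort hα hQ)

lemma densityNorm_mul_rpow_ne_zero (hα : 0 < α) (hP : HasLpDensity α μ P)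
    (hQ : HasLpDensity α μ Q) : densityNorm α μ P * densityNorm α μ Q ^ (α - 1) ≠ 0 :=
  mul_ne_zero (hP.densityNorm_ne_zero hα) (ENNReal.rpow_pos
    (pos_iff_ne_zero.2 (hQ.densityNorm_ne_zero hα)) (hQ.densityNorm_ne_top hα)).ne'

lemma densityNorm_mul_rpow_ne_top (hα : 0 < α) (hP : HasLpDensity α μ P)
    (hQ : HasLpDensity α μ Q) : densityNorm α μ P * densityNorm α μ Q ^ (α - 1) ≠ ⊤ :=
  ENNReal.mul_ne_top (hP.densityNorm_ne_top hα)
    (ENNReal.rpow_ne_top_of_ne_zero (hQ.densityNorm_ne_zero hα) (hQ.densityNorm_ne_top hα))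

lemma densityNorm_mul_rpow_le_crossIntegral (hα : 0 < α) (hα1 : α < 1) (hP : HasLpDensity α μ P)
    (hQ : HasLpDensity α μ Q) :
    densityNorm α μ P * densityNorm α μ Q ^ (α - 1) ≤ crossIntegral α μ P Q := by
  have h := one_le_normalizedCrossIntegral hα hα1 hP hQ
  rwa [normalizedCrossIntegral,
    ENNReal.le_div_iff_mul_le (.inl (densityNorm_mul_rpow_ne_zero hα hP hQ))
      (.inl (densityNorm_mul_rpow_ne_top hα hP hQ)), one_mul] at h

lemma crossIntegral_le_densityNorm_mul_rpow (hα1 : 1 < α) (hP : HasLpDensity α μ P)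
    (hQ : HasLpDensity α μ Q) :
    crossIntegral α μ P Q ≤ densityNorm α μ P * densityNorm α μ Q ^ (α - 1) := by
  have hα : 0 < α := zero_lt_one.trans hα1
  have h := normalizedCrossIntegral_le_one hα1 hP hQ
  rwa [normalizedCrossIntegral,
    ENNReal.div_le_iff (densityNorm_mul_rpow_ne_zero hα hP hQ)
      (densityNorm_mul_rpow_ne_top hα hP hQ), one_mul] at h

lemma eq_of_normalizedCrossIntegral_eq_one (hα : 0 < α) (hα1 : α ≠ 1) (hP : IsAdmissible α μ P)
    (hQ : IsAdmissible α μ Q) (h : normalizedCrossIntegral α μ P Q = 1) : P = Q := by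
  have hPd := hP.hasLpDensity
  have hQd := hQ.hasLpDensity
  have := hP.isProb
  have := hQ.isProb
  rw [← hellingerIntegral_escort hα hPd hQd] at h
  have hescort : escort α μ P =ᵐ[μ] escort α μ Q :=
    ae_eq_of_hellingerIntegral_eq_one (inv_pos.2 hα) (inv_ne_one.2 hα1) measurable_escort
      measurable_escort (lintegral_escort hα hPd) (lintegral_escort hα hQd) h
  have hdiv : (fun x => P.rnDeriv μ x * (densityNorm α μ P)⁻¹) =ᵐ[μ]
      fun x => Q.rnDeriv μ x * (densityNorm α μ Q)⁻¹ := by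
    filter_upwards [hescort] with x hx
    rw [← div_eq_mul_inv, ← div_eq_mul_inv, ← escort_rpow_inv hα, ← escort_rpow_inv hα, hx]
  have hnorm : (densityNorm α μ P)⁻¹ = (densityNorm α μ Q)⁻¹ := by
    have hint := lintegral_congr_ae hdiv
    rwa [lintegral_mul_const _ (by fun_prop), lintegral_mul_const _ (by fun_prop),
      Measure.lintegral_rnDeriv hP.absCont, Measure.lintegral_rnDeriv hQ.absCont, measure_univ,
      measure_univ, one_mul, one_mul] at hint
  have hdensity : P.rnDeriv μ =ᵐ[μ] Q.rnDeriv μ := by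
    filter_upwards [hdiv] with x hx
    rw [hnorm] at hx
    exact (ENNReal.mul_left_inj (ENNReal.inv_ne_zero.2 (hQd.densityNorm_ne_top hα))
      (ENNReal.inv_ne_top.2 (hQd.densityNorm_ne_zero hα))).1 hx
  rw [← Measure.withDensity_rnDeriv_eq P μ hP.absCont, withDensity_congr_ae hdensity,
    Measure.withDensity_rnDeriv_eq Q μ hQ.absCont]

end CrossIntegral

section RelEntropy

variable {α : ℝ} {P P' Q Q' R : Measure X}

lemma inv_sub_one_inv_pos (hα : 0 < α) (hα1 : α < 1) : 0 < (α⁻¹ - 1)⁻¹ :=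
  inv_pos.2 (sub_pos.2 ((one_lt_inv₀ hα).2 hα1))

lemma inv_sub_one_inv_neg (hα1 : 1 < α) : (α⁻¹ - 1)⁻¹ < 0 :=
  inv_lt_zero.2 (sub_neg.2 (inv_lt_one_of_one_lt₀ hα1))

lemma rpow_le_rpow_iff_of_neg {x y : ℝ≥0∞} {z : ℝ} (hz : z < 0) : x ^ z ≤ y ^ z ↔ y ≤ x := by
  rw [← neg_neg z, ENNReal.rpow_neg x, ENNReal.rpow_neg y, ENNReal.inv_le_inv,
    ENNReal.rpow_le_rpow_iff (neg_pos.2 hz)]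

variable [SigmaFinite μ]

lemma relEntropy_eq_log (hα : 0 < α) (hα1 : α ≠ 1) (hP : HasLpDensity α μ P)
    (hQ : HasLpDensity α μ Q) :
    relEntropy α μ P Q = ENNReal.log (normalizedCrossIntegral α μ P Q ^ (α⁻¹ - 1)⁻¹) := by
  have hescort_ne_top : ∀ᵐ x ∂μ, escort α μ P x ≠ ⊤ :=
    ae_ne_top_of_lintegral_eq_one measurable_escort (lintegral_escort hα hP)
  have hfDiv := sign_mul_fDiv_add_lintegral (inv_pos.2 hα) (inv_ne_one.2 hα1)
    (a := escort α μ P) (b := escort α μ Q) measurable_escort measurable_escort hescort_ne_top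
    (by simp [lintegral_escort hα hQ])
  rw [lintegral_escort hα hQ, EReal.coe_ennreal_one, hellingerIntegral_escort hα hP hQ] at hfDiv
  rw [relEntropy, hfDiv, EReal.toENNReal_coe, ENNReal.log_rpow]

lemma relEntropy_le_iff_of_lt_one (hα : 0 < α) (hα1 : α < 1) (hP : HasLpDensity α μ P)
    (hQ : HasLpDensity α μ Q) (hP' : HasLpDensity α μ P') (hQ' : HasLpDensity α μ Q') :
    relEntropy α μ P Q ≤ relEntropy α μ P' Q' ↔
      normalizedCrossIntegral α μ P Q ≤ normalizedCrossIntegral α μ P' Q' := by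
  rw [relEntropy_eq_log hα hα1.ne hP hQ, relEntropy_eq_log hα hα1.ne hP' hQ',
    ENNReal.log_strictMono.le_iff_le, ENNReal.rpow_le_rpow_iff (inv_sub_one_inv_pos hα hα1)]

lemma relEntropy_le_iff_of_one_lt (hα1 : 1 < α) (hP : HasLpDensity α μ P)
    (hQ : HasLpDensity α μ Q) (hP' : HasLpDensity α μ P') (hQ' : HasLpDensity α μ Q') :
    relEntropy α μ P Q ≤ relEntropy α μ P' Q' ↔
      normalizedCrossIntegral α μ P' Q' ≤ normalizedCrossIntegral α μ P Q := by
  have hα : 0 < α := zero_lt_one.trans hα1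
  rw [relEntropy_eq_log hα hα1.ne' hP hQ, relEntropy_eq_log hα hα1.ne' hP' hQ',
    ENNReal.log_strictMono.le_iff_le, rpow_le_rpow_iff_of_neg (inv_sub_one_inv_neg hα1)]

lemma relEntropy_lt_top_iff_of_lt_one (hα : 0 < α) (hα1 : α < 1) (hP : HasLpDensity α μ P)
    (hQ : HasLpDensity α μ Q) : relEntropy α μ P Q < ⊤ ↔ crossIntegral α μ P Q ≠ ⊤ := by
  have hκ := inv_sub_one_inv_pos hα hα1
  rw [relEntropy_eq_log hα hα1.ne hP hQ, lt_top_iff_ne_top, Ne, ENNReal.log_eq_top_iff,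
    ENNReal.rpow_eq_top_iff_of_pos hκ, normalizedCrossIntegral, ENNReal.div_eq_top]
  simp only [densityNorm_mul_rpow_ne_zero hα hP hQ, densityNorm_mul_rpow_ne_top hα hP hQ, and_false,
    false_or, ne_eq, not_false_eq_true, and_true]

lemma relEntropy_lt_top_iff_of_one_lt (hα1 : 1 < α) (hP : HasLpDensity α μ P)
    (hQ : HasLpDensity α μ Q) : relEntropy α μ P Q < ⊤ ↔ crossIntegral α μ P Q ≠ 0 := by
  have hα : 0 < α := zero_lt_one.trans hα1
  have hκ := inv_sub_one_inv_neg hα1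
  rw [relEntropy_eq_log hα hα1.ne' hP hQ, lt_top_iff_ne_top, Ne, ENNReal.log_eq_top_iff,
    ENNReal.rpow_eq_top_iff, normalizedCrossIntegral, ENNReal.div_eq_zero_iff]
  simp only [densityNorm_mul_rpow_ne_top hα hP hQ, hκ, hκ.not_gt, or_false, and_true, and_false]

lemma relEntropy_nonneg (hα : 0 < α) (hα1 : α ≠ 1) (hP : HasLpDensity α μ P)
    (hQ : HasLpDensity α μ Q) : 0 ≤ relEntropy α μ P Q := by
  rw [relEntropy_eq_log hα hα1 hP hQ, ← ENNReal.log_one]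
  refine ENNReal.log_monotone ?_
  rcases hα1.lt_or_gt with h | h
  · exact ENNReal.one_le_rpow (one_le_normalizedCrossIntegral hα h hP hQ)
      (inv_sub_one_inv_pos hα h)
  · rw [← ENNReal.one_rpow (α⁻¹ - 1)⁻¹, rpow_le_rpow_iff_of_neg (inv_sub_one_inv_neg h)]
    exact normalizedCrossIntegral_le_one h hP hQ

lemma eq_of_relEntropy_eq_zero (hα : 0 < α) (hα1 : α ≠ 1) (hP : IsAdmissible α μ P)
    (hQ : IsAdmissible α μ Q) (h : relEntropy α μ P Q = 0) : P = Q := by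
  have hκ : (α⁻¹ - 1)⁻¹ ≠ 0 := inv_ne_zero (sub_ne_zero.2 (inv_ne_one.2 hα1))
  rw [relEntropy_eq_log hα hα1 hP.hasLpDensity hQ.hasLpDensity, ← ENNReal.log_one,
    ENNReal.log_eq_iff, ← ENNReal.one_rpow (α⁻¹ - 1)⁻¹,
    (ENNReal.rpow_left_injective hκ).eq_iff] at h
  exact eq_of_normalizedCrossIntegral_eq_one hα hα1 hP hQ h

lemma relEntropy_add_relEntropy (hα : 0 < α) (hα1 : α ≠ 1) (hP : HasLpDensity α μ P)
    (hQ : HasLpDensity α μ Q) (hR : HasLpDensity α μ R) :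
    relEntropy α μ P Q + relEntropy α μ Q R =
      ENNReal.log ((normalizedCrossIntegral α μ P Q * normalizedCrossIntegral α μ Q R)
        ^ (α⁻¹ - 1)⁻¹) := by
  rw [relEntropy_eq_log hα hα1 hP hQ, relEntropy_eq_log hα hα1 hQ hR, ← ENNReal.log_mul_add]
  rcases hα1.lt_or_gt with h | h
  · rw [ENNReal.mul_rpow_of_nonneg _ _ (inv_sub_one_inv_pos hα h).le]
  · rw [ENNReal.mul_rpow_of_ne_top
      (ne_top_of_le_ne_top ENNReal.one_ne_top (normalizedCrossIntegral_le_one h hP hQ))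
      (ne_top_of_le_ne_top ENNReal.one_ne_top (normalizedCrossIntegral_le_one h hQ hR))]

end RelEntropy

section Pythagoras

variable {α c : ℝ} {P Q R : Measure X} {g : X → ℝ} {N : Set X}

lemma eq_ofReal_of_coe_eq {a b : ℝ≥0∞} {c g : ℝ} (hb : b ≠ ⊤)
    (h : (a : EReal) = (c : EReal) * (b : EReal) + (g : EReal)) :
    a = ENNReal.ofReal (c * b.toReal + g) ∧ 0 ≤ c * b.toReal + g := by
  lift b to NNReal using hb
  have ha : (a : EReal) = ((c * b + g : ℝ) : EReal) := by rw [h]; push_cast; rfl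
  have h0 : 0 ≤ c * (b : ℝ) + g := by
    rw [← EReal.coe_nonneg, ← ha]; exact EReal.coe_ennreal_nonneg a
  refine ⟨?_, h0⟩
  rw [← EReal.coe_ennreal_eq_coe_ennreal_iff, ha, ENNReal.coe_toReal,
    EReal.coe_ennreal_ofReal, max_eq_left h0]

lemma coe_eq_inv_mul_add_of_coe_eq {a b : ℝ≥0∞} {c g : ℝ} (hc : c ≠ 0) (ha : a ≠ ⊤)
    (h : (a : EReal) = (c : EReal) * (b : EReal) + (g : EReal)) :
    (b : EReal) = ((c⁻¹ : ℝ) : EReal) * (a : EReal) + ((-(c⁻¹ * g) : ℝ) : EReal) := by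
  have hb : b ≠ ⊤ := by
    rintro rfl
    rw [EReal.coe_ennreal_top] at h
    rcases hc.lt_or_gt with hc | hc
    · rw [EReal.coe_mul_top_of_neg hc, EReal.bot_add] at h
      exact EReal.coe_ennreal_ne_bot _ h
    · rw [EReal.coe_mul_top_of_pos hc, EReal.top_add_coe] at h
      exact ha (EReal.coe_ennreal_eq_top_iff.1 h)
  lift a to NNReal using ha
  lift b to NNReal using hb
  have hreal : (a : ℝ) = c * b + g := EReal.coe_injective (by push_cast; exact h)
  have hreal' : (b : ℝ) = c⁻¹ * a + -(c⁻¹ * g) := by rw [hreal]; field_simp; ring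
  exact (congrArg Real.toEReal hreal').trans (by push_cast; rfl)

lemma lintegral_eq_ofReal_of_ae_coe_eq {u v : X → ℝ≥0∞} (hv : AEMeasurable v μ)
    (hv_top : ∫⁻ x, v x ∂μ ≠ ⊤) (hg : Integrable g μ)
    (h : ∀ᵐ x ∂μ, (u x : EReal) = (c : EReal) * (v x : EReal) + (g x : EReal)) :
    ∫⁻ x, u x ∂μ = ENNReal.ofReal (c * (∫⁻ x, v x ∂μ).toReal + ∫ x, g x ∂μ) := by
  have hv_ae : ∀ᵐ x ∂μ, v x < ⊤ := ae_lt_top' hv hv_top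
  have hreal : ∀ᵐ x ∂μ, u x = ENNReal.ofReal (c * (v x).toReal + g x) ∧
      0 ≤ c * (v x).toReal + g x := by
    filter_upwards [h, hv_ae] with x hx hvx using eq_ofReal_of_coe_eq hvx.ne hx
  have hvi : Integrable (fun x => c * (v x).toReal) μ :=
    (integrable_toReal_of_lintegral_ne_top hv hv_top).const_mul c
  calc ∫⁻ x, u x ∂μ = ∫⁻ x, ENNReal.ofReal (c * (v x).toReal + g x) ∂μ :=
        lintegral_congr_ae (hreal.mono fun x hx => hx.1)
    _ = ENNReal.ofReal (∫ x, (c * (v x).toReal + g x) ∂μ) :=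
        (ofReal_integral_eq_lintegral_ofReal (hvi.add hg) (hreal.mono fun x hx => hx.2)).symm
    _ = ENNReal.ofReal (c * (∫⁻ x, v x ∂μ).toReal + ∫ x, g x ∂μ) := by
        rw [integral_add hvi hg, integral_const_mul, integral_toReal hv hv_ae]

lemma integrable_and_integral_eq_zero_of_mem_span {Γ : Type*} {f : Γ → X → ℝ}
    (hf : ∀ γ, Integrable (f γ) P ∧ ∫ x, f γ x ∂P = 0)
    (hg : g ∈ Submodule.span ℝ (Set.range f)) : Integrable g P ∧ ∫ x, g x ∂P = 0 := by
  induction hg using Submodule.span_induction with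
  | mem x hx =>
    obtain ⟨γ, rfl⟩ := hx
    exact hf γ
  | zero => exact ⟨integrable_zero _ _ _, by simp⟩
  | add x y _ _ hx hy => exact ⟨hx.1.add hy.1, by simp [integral_add hx.1 hy.1, hx.2, hy.2]⟩
  | smul a x _ hx => exact ⟨hx.1.smul a, by simp [integral_const_mul, hx.2]⟩

lemma HasPowerLawForm.crossIntegral_eq (hP : HasLpDensity α μ P) (hc : 0 ≤ c)
    (h : HasPowerLawForm α μ Q R c g N) (hg : Integrable g P) (hg0 : ∫ x, g x ∂P = 0)
    (hPN : P N = 0) (hPR : crossIntegral α μ P R ≠ ⊤) :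
    crossIntegral α μ P Q = ENNReal.ofReal c * crossIntegral α μ P R := by
  have hlaw : ∀ᵐ x ∂P, (((Q.rnDeriv μ x) ^ (α - 1) : ℝ≥0∞) : EReal)
      = (c : EReal) * (((R.rnDeriv μ x) ^ (α - 1) : ℝ≥0∞) : EReal) + (g x : EReal) := by
    filter_upwards [hP.absCont.ae_le h, measure_eq_zero_iff_ae_notMem.1 hPN] with x hx hxN
    exact hx.1 hxN
  rw [crossIntegral, lintegral_eq_ofReal_of_ae_coe_eq (by fun_prop) hPR hg hlaw, hg0, add_zero,
    ENNReal.ofReal_mul hc, ← crossIntegral, ENNReal.ofReal_toReal hPR]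

lemma HasPowerLawForm.mul_crossIntegral_le (hP : HasLpDensity α μ P) (hc : 0 ≤ c)
    (hN : MeasurableSet N) (h : HasPowerLawForm α μ Q R c g N) (hg : IntegrableOn g Nᶜ P)
    (hPR : crossIntegral α μ P R ≠ ⊤)
    (hside : (c : EReal) * ((∫⁻ x in N, (R.rnDeriv μ x) ^ (α - 1) ∂P : ℝ≥0∞) : EReal)
        ≤ ((∫ x in Nᶜ, g x ∂P : ℝ) : EReal)) :
    ENNReal.ofReal c * crossIntegral α μ P R ≤ crossIntegral α μ P Q := by
  have hsplit := lintegral_add_compl (fun x => (R.rnDeriv μ x) ^ (α - 1)) hN (μ := P)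
  have hN_top : ∫⁻ x in N, (R.rnDeriv μ x) ^ (α - 1) ∂P ≠ ⊤ :=
    ne_top_of_le_ne_top hPR (setLIntegral_le_lintegral _ _)
  have hNc_top : ∫⁻ x in Nᶜ, (R.rnDeriv μ x) ^ (α - 1) ∂P ≠ ⊤ :=
    ne_top_of_le_ne_top hPR (setLIntegral_le_lintegral _ _)
  have hlaw : ∀ᵐ x ∂P.restrict Nᶜ, (((Q.rnDeriv μ x) ^ (α - 1) : ℝ≥0∞) : EReal)
      = (c : EReal) * (((R.rnDeriv μ x) ^ (α - 1) : ℝ≥0∞) : EReal) + (g x : EReal) := by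
    refine (ae_restrict_iff' hN.compl).2 ?_
    filter_upwards [hP.absCont.ae_le h] with x hx using hx.1
  have hside_real : c * (∫⁻ x in N, (R.rnDeriv μ x) ^ (α - 1) ∂P).toReal ≤ ∫ x in Nᶜ, g x ∂P := by
    rw [← EReal.coe_toReal (by simpa using hN_top) (EReal.coe_ennreal_ne_bot _),
      EReal.toReal_coe_ennreal] at hside
    exact_mod_cast hside
  calc ENNReal.ofReal c * crossIntegral α μ P R
      = ENNReal.ofReal (c * (∫⁻ x in Nᶜ, (R.rnDeriv μ x) ^ (α - 1) ∂P).toReal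
          + c * (∫⁻ x in N, (R.rnDeriv μ x) ^ (α - 1) ∂P).toReal) := by
        rw [← mul_add, ← ENNReal.toReal_add hNc_top hN_top, add_comm, hsplit,
          ENNReal.ofReal_mul hc, ← crossIntegral, ENNReal.ofReal_toReal hPR]
    _ ≤ ENNReal.ofReal (c * (∫⁻ x in Nᶜ, (R.rnDeriv μ x) ^ (α - 1) ∂P).toReal
          + ∫ x in Nᶜ, g x ∂P) := by gcongr
    _ = ∫⁻ x in Nᶜ, (Q.rnDeriv μ x) ^ (α - 1) ∂P :=
        (lintegral_eq_ofReal_of_ae_coe_eq (by fun_prop) hNc_top hg hlaw).symm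
    _ ≤ crossIntegral α μ P Q := setLIntegral_le_lintegral _ _

variable [SigmaFinite μ]

lemma HasPowerLawForm.ae_self (hQ : HasLpDensity α μ Q) (h : HasPowerLawForm α μ Q R c g N) :
    ∀ᵐ x ∂Q, (((Q.rnDeriv μ x) ^ (α - 1) : ℝ≥0∞) : EReal)
      = (c : EReal) * (((R.rnDeriv μ x) ^ (α - 1) : ℝ≥0∞) : EReal) + (g x : EReal) := by
  filter_upwards [hQ.absCont.ae_le h, hQ.ae_self_rnDeriv_ne_zero] with x hx hq
  exact hx.1 fun hxN => hq (hx.2 hxN)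

lemma HasLpDensity.crossIntegral_self_ne_zero (hα : 0 < α) (hQ : HasLpDensity α μ Q) :
    crossIntegral α μ Q Q ≠ 0 := by
  rw [crossIntegral_self hα hQ, ← densityNorm_mul_rpow_sub_one hα hQ]
  exact densityNorm_mul_rpow_ne_zero hα hQ hQ

lemma HasLpDensity.crossIntegral_self_ne_top (hα : 0 < α) (hQ : HasLpDensity α μ Q) :
    crossIntegral α μ Q Q ≠ ⊤ := by
  rw [crossIntegral_self hα hQ, ← densityNorm_mul_rpow_sub_one hα hQ]
  exact densityNorm_mul_rpow_ne_top hα hQ hQ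

lemma HasPowerLawForm.const_ne_zero (hα : 0 < α) (hQ : HasLpDensity α μ Q)
    (h : HasPowerLawForm α μ Q R c g N) (hg : Integrable g Q) (hg0 : ∫ x, g x ∂Q = 0) :
    c ≠ 0 := by
  rintro rfl
  have hself : ∀ᵐ x ∂Q, (((Q.rnDeriv μ x) ^ (α - 1) : ℝ≥0∞) : EReal)
      = ((0 : ℝ) : EReal) * ((0 : ℝ≥0∞) : EReal) + (g x : EReal) := by
    filter_upwards [h.ae_self hQ] with x hx
    simpa using hx
  refine hQ.crossIntegral_self_ne_zero hα ?_
  rw [crossIntegral, lintegral_eq_ofReal_of_ae_coe_eq aemeasurable_const (by simp) hg hself, hg0]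
  simp

/-- The power law is solved for `r ^ (α - 1)` and integrated against `Q`. -/
lemma HasPowerLawForm.crossIntegral_ne_top (hα : 0 < α) (hQ : HasLpDensity α μ Q)
    (h : HasPowerLawForm α μ Q R c g N) (hg : Integrable g Q) (hg0 : ∫ x, g x ∂Q = 0) :
    crossIntegral α μ Q R ≠ ⊤ := by
  have htop := hQ.crossIntegral_self_ne_top hα
  have hinv : ∀ᵐ x ∂Q, (((R.rnDeriv μ x) ^ (α - 1) : ℝ≥0∞) : EReal) =
      ((c⁻¹ : ℝ) : EReal) * (((Q.rnDeriv μ x) ^ (α - 1) : ℝ≥0∞) : EReal) +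
        ((-(c⁻¹ * g x) : ℝ) : EReal) := by
    filter_upwards [h.ae_self hQ, ae_lt_top (by fun_prop) htop] with x hx hqx
    exact coe_eq_inv_mul_add_of_coe_eq (h.const_ne_zero hα hQ hg hg0) hqx.ne hx
  rw [crossIntegral,
    lintegral_eq_ofReal_of_ae_coe_eq (by fun_prop) htop (hg.const_mul c⁻¹).neg hinv]
  exact ENNReal.ofReal_ne_top

lemma HasPowerLawForm.densityNorm_rpow_eq_ofReal (hα : 0 < α) (hQ : HasLpDensity α μ Q)
    (h : HasPowerLawForm α μ Q R c g N) (hg : Integrable g Q) (hg0 : ∫ x, g x ∂Q = 0) :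
    densityNorm α μ Q ^ α = ENNReal.ofReal (c * (crossIntegral α μ Q R).toReal) := by
  rw [← crossIntegral_self hα hQ, crossIntegral, lintegral_eq_ofReal_of_ae_coe_eq (by fun_prop)
    (h.crossIntegral_ne_top hα hQ hg hg0) hg (h.ae_self hQ), hg0, add_zero, crossIntegral]

lemma HasPowerLawForm.const_pos (hα : 0 < α) (hQ : HasLpDensity α μ Q)
    (h : HasPowerLawForm α μ Q R c g N) (hg : Integrable g Q) (hg0 : ∫ x, g x ∂Q = 0) :
    0 < c := by
  refine pos_of_mul_pos_left (b := (crossIntegral α μ Q R).toReal) ?_ ENNReal.toReal_nonneg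
  rw [← ENNReal.ofReal_pos, ← h.densityNorm_rpow_eq_ofReal hα hQ hg hg0,
    ← crossIntegral_self hα hQ]
  exact pos_iff_ne_zero.2 (hQ.crossIntegral_self_ne_zero hα)

lemma HasPowerLawForm.densityNorm_rpow_eq (hα : 0 < α) (hQ : HasLpDensity α μ Q)
    (h : HasPowerLawForm α μ Q R c g N) (hg : Integrable g Q) (hg0 : ∫ x, g x ∂Q = 0) :
    densityNorm α μ Q ^ α = ENNReal.ofReal c * crossIntegral α μ Q R := by
  rw [h.densityNorm_rpow_eq_ofReal hα hQ hg hg0,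
    ENNReal.ofReal_mul (h.const_pos hα hQ hg hg0).le,
    ENNReal.ofReal_toReal (h.crossIntegral_ne_top hα hQ hg hg0)]

lemma normalizedCrossIntegral_mul_normalizedCrossIntegral (hα : 0 < α) (hP : HasLpDensity α μ P)
    (hQ : HasLpDensity α μ Q) :
    normalizedCrossIntegral α μ P Q * normalizedCrossIntegral α μ Q R =
      crossIntegral α μ P Q * crossIntegral α μ Q R / densityNorm α μ Q ^ α
        / (densityNorm α μ P * densityNorm α μ R ^ (α - 1)) := by
  have hPQ := densityNorm_mul_rpow_ne_zero hα hP hQ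
  have hPQ' := densityNorm_mul_rpow_ne_top hα hP hQ
  have hQQ := densityNorm_mul_rpow_ne_zero hα hQ hQ
  have hQQ' := densityNorm_mul_rpow_ne_top hα hQ hQ
  simp only [normalizedCrossIntegral, ← densityNorm_mul_rpow_sub_one hα hQ, div_eq_mul_inv]
  rw [mul_mul_mul_comm, ← ENNReal.mul_inv (.inl hPQ) (.inl hPQ'), mul_assoc (_ * _) _⁻¹ _⁻¹,
    ← ENNReal.mul_inv (.inl hQQ) (.inl hQQ')]
  congr 2
  ring

lemma relEntropy_eq_add (hα : 0 < α) (hα1 : α ≠ 1) (hP : HasLpDensity α μ P)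
    (hQ : HasLpDensity α μ Q) (hR : HasLpDensity α μ R)
    (h : crossIntegral α μ P Q * crossIntegral α μ Q R
      = densityNorm α μ Q ^ α * crossIntegral α μ P R) :
    relEntropy α μ P R = relEntropy α μ P Q + relEntropy α μ Q R := by
  rw [relEntropy_add_relEntropy hα hα1 hP hQ hR, relEntropy_eq_log hα hα1 hP hR,
    normalizedCrossIntegral_mul_normalizedCrossIntegral hα hP hQ, h, mul_comm,
    ← crossIntegral_self hα hQ, ENNReal.mul_div_cancel_right (hQ.crossIntegral_self_ne_zero hα)
      (hQ.crossIntegral_self_ne_top hα), normalizedCrossIntegral]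

lemma relEntropy_add_le_of_one_lt (hα1 : 1 < α) (hP : HasLpDensity α μ P)
    (hQ : HasLpDensity α μ Q) (hR : HasLpDensity α μ R)
    (h : densityNorm α μ Q ^ α * crossIntegral α μ P R
      ≤ crossIntegral α μ P Q * crossIntegral α μ Q R) :
    relEntropy α μ P Q + relEntropy α μ Q R ≤ relEntropy α μ P R := by
  have hα : 0 < α := zero_lt_one.trans hα1
  rw [relEntropy_add_relEntropy hα hα1.ne' hP hQ hR, relEntropy_eq_log hα hα1.ne' hP hR,
    ENNReal.log_strictMono.le_iff_le, rpow_le_rpow_iff_of_neg (inv_sub_one_inv_neg hα1),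
    normalizedCrossIntegral_mul_normalizedCrossIntegral hα hP hQ, normalizedCrossIntegral]
  gcongr
  rw [← crossIntegral_self hα hQ] at h ⊢
  rwa [ENNReal.le_div_iff_mul_le (.inl (hQ.crossIntegral_self_ne_zero hα))
      (.inl (hQ.crossIntegral_self_ne_top hα)), mul_comm]

lemma HasPowerLawForm.relEntropy_lt_top (hα : 0 < α) (hα1 : α ≠ 1) (hQ : HasLpDensity α μ Q)
    (hR : HasLpDensity α μ R) (h : HasPowerLawForm α μ Q R c g N) (hg : Integrable g Q)
    (hg0 : ∫ x, g x ∂Q = 0) : relEntropy α μ Q R < ⊤ := by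
  rcases hα1.lt_or_gt with hlt | hgt
  · exact (relEntropy_lt_top_iff_of_lt_one hα hlt hQ hR).2 (h.crossIntegral_ne_top hα hQ hg hg0)
  · rw [relEntropy_lt_top_iff_of_one_lt hgt hQ hR]
    intro hzero
    refine hQ.crossIntegral_self_ne_zero hα ?_
    rw [crossIntegral_self hα hQ, h.densityNorm_rpow_eq hα hQ hg hg0, hzero, mul_zero]

lemma HasPowerLawForm.relEntropy_eq_add {Γ : Type*} {f : Γ → X → ℝ} (hα : 0 < α) (hα1 : α < 1)
    (hR : HasLpDensity α μ R) (hQ : Q ∈ linearFamily α μ f)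
    (hg : g ∈ Submodule.span ℝ (Set.range f)) (h : HasPowerLawForm α μ Q R c g N)
    (hs : SideCondition α μ (linearFamily α μ f) R c g N) (hP : P ∈ linearFamily α μ f)
    (hPR : relEntropy α μ P R < ⊤) :
    relEntropy α μ P R = relEntropy α μ P Q + relEntropy α μ Q R := by
  have hPd := hP.1.hasLpDensity
  have hQd := hQ.1.hasLpDensity
  obtain ⟨hgP, hgP0⟩ := integrable_and_integral_eq_zero_of_mem_span hP.2 hg
  obtain ⟨hgQ, hgQ0⟩ := integrable_and_integral_eq_zero_of_mem_span hQ.2 hg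
  refine RelAlpha.relEntropy_eq_add hα hα1.ne hPd hQd hR ?_
  rw [h.densityNorm_rpow_eq hα hQd hgQ hgQ0, h.crossIntegral_eq hPd (h.const_pos hα hQd hgQ hgQ0).le
    hgP hgP0 ((hs P hP hPR).1 hα1) ((relEntropy_lt_top_iff_of_lt_one hα hα1 hPd hR).1 hPR)]
  ring

lemma HasPowerLawForm.relEntropy_add_le {Γ : Type*} {f : Γ → X → ℝ} (hα1 : 1 < α)
    (hR : HasLpDensity α μ R) (hQ : Q ∈ linearFamily α μ f) (hN : MeasurableSet N)
    (hg : g ∈ Submodule.span ℝ (Set.range f)) (h : HasPowerLawForm α μ Q R c g N)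
    (hs : SideCondition α μ (linearFamily α μ f) R c g N) (hP : P ∈ linearFamily α μ f)
    (hPR : relEntropy α μ P R < ⊤) :
    relEntropy α μ P Q + relEntropy α μ Q R ≤ relEntropy α μ P R := by
  have hα : 0 < α := zero_lt_one.trans hα1
  have hPd := hP.1.hasLpDensity
  have hQd := hQ.1.hasLpDensity
  obtain ⟨hgQ, hgQ0⟩ := integrable_and_integral_eq_zero_of_mem_span hQ.2 hg
  obtain ⟨hgN, hside⟩ := (hs P hP hPR).2 hα1
  have hPR_top : crossIntegral α μ P R ≠ ⊤ := ne_top_of_le_ne_top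
    (densityNorm_mul_rpow_ne_top hα hPd hR) (crossIntegral_le_densityNorm_mul_rpow hα1 hPd hR)
  have hle := h.mul_crossIntegral_le hPd (h.const_pos hα hQd hgQ hgQ0).le hN hgN hPR_top hside
  refine relEntropy_add_le_of_one_lt hα1 hPd hQd hR ?_
  rw [h.densityNorm_rpow_eq hα hQd hgQ hgQ0, mul_right_comm]
  gcongr

lemma HasPowerLawForm.relEntropy_add_le_and_eq {Γ : Type*} {f : Γ → X → ℝ} (hα : 0 < α)
    (hα1 : α ≠ 1) (hR : HasLpDensity α μ R) (hQ : Q ∈ linearFamily α μ f) (hN : MeasurableSet N)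
    (hg : g ∈ Submodule.span ℝ (Set.range f)) (h : HasPowerLawForm α μ Q R c g N)
    (hs : SideCondition α μ (linearFamily α μ f) R c g N) (hP : P ∈ linearFamily α μ f)
    (hPR : relEntropy α μ P R < ⊤) :
    relEntropy α μ P Q + relEntropy α μ Q R ≤ relEntropy α μ P R ∧
      (α < 1 → relEntropy α μ P R = relEntropy α μ P Q + relEntropy α μ Q R) := by
  rcases hα1.lt_or_gt with hlt | hgt
  · have heq := h.relEntropy_eq_add hα hlt hR hQ hg hs hP hPR
    exact ⟨heq.ge, fun _ => heq⟩
  · exact ⟨h.relEntropy_add_le hgt hR hQ hN hg hs hP hPR, fun hlt => absurd hlt hgt.not_gt⟩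

lemma isForwardProjection_unique_of_pythagoras {E : Set (Measure X)} (hα : 0 < α) (hα1 : α ≠ 1)
    (hE : ∀ P ∈ E, IsAdmissible α μ P) (hR : HasLpDensity α μ R) (hQ : Q ∈ E)
    (hfin : relEntropy α μ Q R < ⊤)
    (hpyth : ∀ P ∈ E, relEntropy α μ P R < ⊤ →
      relEntropy α μ P Q + relEntropy α μ Q R ≤ relEntropy α μ P R) :
    IsForwardProjection α μ E R Q ∧ ∀ Q', IsForwardProjection α μ E R Q' → Q' = Q := by
  have hnonneg : ∀ P ∈ E, 0 ≤ relEntropy α μ P Q := fun P hP =>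
    relEntropy_nonneg hα hα1 (hE P hP).hasLpDensity (hE Q hQ).hasLpDensity
  have hmin : relEntropy α μ Q R = ⨅ P ∈ E, relEntropy α μ P R := by
    refine le_antisymm (le_iInf₂ fun P hP => ?_) (iInf₂_le Q hQ)
    rcases lt_or_ge (relEntropy α μ P R) ⊤ with hPR | hPR
    · exact (le_add_of_nonneg_left (hnonneg P hP)).trans (hpyth P hP hPR)
    · exact le_top.trans hPR
  refine ⟨⟨⟨Q, hQ, hfin⟩, hQ, hmin⟩, fun Q' hQ' => ?_⟩
  have heq : relEntropy α μ Q' R = relEntropy α μ Q R := hQ'.eq_iInf.trans hmin.symm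
  have hpythQ' := hpyth Q' hQ'.mem (heq ▸ hfin)
  have hQR := relEntropy_nonneg hα hα1 (hE Q hQ).hasLpDensity hR
  refine eq_of_relEntropy_eq_zero hα hα1 (hE Q' hQ'.mem) (hE Q hQ)
    (le_antisymm ?_ (hnonneg Q' hQ'.mem))
  lift relEntropy α μ Q R to ℝ using ⟨hfin.ne, (lt_of_lt_of_le EReal.bot_lt_zero hQR).ne'⟩ with y
  rw [heq] at hpythQ'
  exact (EReal.addLECancellable_coe y).add_le_add_iff_right.1 (hpythQ'.trans_eq (zero_add _).symm)

end Pythagoras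

section Perturbation

variable {α : ℝ} {P Q R : Measure X} {t : ℝ≥0}

lemma crossIntegral_add_left :
    crossIntegral α μ (P + Q) R = crossIntegral α μ P R + crossIntegral α μ Q R :=
  lintegral_add_measure _ _ _

lemma crossIntegral_smul_left :
    crossIntegral α μ (t • P) R = t * crossIntegral α μ P R :=
  lintegral_smul_measure _ _

variable [SigmaFinite μ]

lemma HasLpDensity.add (hα : 0 < α) (hP : HasLpDensity α μ P)
    (hQ : HasLpDensity α μ Q) : HasLpDensity α μ (P + Q) := by
  have := hP.isFinite
  have := hQ.isFinite
  refine ⟨inferInstance, fun h => hP.ne_zero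
    (le_antisymm (h ▸ Measure.le_add_right le_rfl) (Measure.zero_le P)),
    hP.absCont.add_left hQ.absCont, ?_⟩
  calc ∫⁻ x, ((P + Q).rnDeriv μ x) ^ α ∂μ
      ≤ ∫⁻ x, _ * ((P.rnDeriv μ x) ^ α + (Q.rnDeriv μ x) ^ α) ∂μ := by
        refine lintegral_mono_ae ?_
        filter_upwards [Measure.rnDeriv_add' P Q μ] with x hx
        rw [hx]
        exact ENNReal.rpow_add_le_mul_rpow_add_rpow' _ _ hα.le
    _ < ⊤ := by
        rw [lintegral_const_mul _ (by fun_prop), lintegral_add_left (by fun_prop)]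
        exact ENNReal.mul_lt_top (ENNReal.LpAddConst_lt_top _)
          (ENNReal.add_lt_top.2 ⟨hP.lintegral_lt_top, hQ.lintegral_lt_top⟩)

lemma lintegral_rnDeriv_smul_rpow (hα : 0 < α) (hP : HasLpDensity α μ P) :
    ∫⁻ x, ((t • P).rnDeriv μ x) ^ α ∂μ = t ^ α * ∫⁻ x, (P.rnDeriv μ x) ^ α ∂μ := by
  have := hP.isFinite
  rw [← lintegral_const_mul _ (by fun_prop)]
  refine lintegral_congr_ae ?_
  filter_upwards [Measure.rnDeriv_smul_left' P μ t] with x hx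
  rw [hx, Pi.smul_apply, ENNReal.smul_def, smul_eq_mul, ENNReal.mul_rpow_of_nonneg _ _ hα.le]

lemma densityNorm_smul (hα : 0 < α) (hP : HasLpDensity α μ P) :
    densityNorm α μ (t • P) = t * densityNorm α μ P := by
  rw [densityNorm, lintegral_rnDeriv_smul_rpow hα hP,
    ENNReal.mul_rpow_of_nonneg _ _ (inv_nonneg.2 hα.le), ENNReal.rpow_rpow_inv hα.ne', densityNorm]

lemma HasLpDensity.smul (hα : 0 < α) (ht : t ≠ 0) (hP : HasLpDensity α μ P) :
    HasLpDensity α μ (t • P) := by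
  have := hP.isFinite
  refine ⟨inferInstance, smul_ne_zero ht hP.ne_zero, hP.absCont.smul_left t, ?_⟩
  rw [lintegral_rnDeriv_smul_rpow hα hP]
  exact ENNReal.mul_lt_top (ENNReal.rpow_lt_top_of_nonneg hα.le ENNReal.coe_ne_top)
    hP.lintegral_lt_top

lemma normalizedCrossIntegral_smul_left (hα : 0 < α) (ht : t ≠ 0) (hP : HasLpDensity α μ P) :
    normalizedCrossIntegral α μ (t • P) R = normalizedCrossIntegral α μ P R := by
  rw [normalizedCrossIntegral, crossIntegral_smul_left, densityNorm_smul hα hP, mul_assoc,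
    ENNReal.mul_div_mul_left _ _ (by simpa using ht) ENNReal.coe_ne_top, normalizedCrossIntegral]

lemma HasLpDensity.rnDeriv_ae_le_of_le (hQ : HasLpDensity α μ Q) (hPQ : P ≤ Q) :
    ∀ᵐ x ∂μ, P.rnDeriv μ x ≤ Q.rnDeriv μ x := by
  have := hQ.isFinite
  have := isFiniteMeasure_of_le Q hPQ
  refine ae_le_of_forall_setLIntegral_le_of_sigmaFinite (by fun_prop) fun s _ _ => ?_
  rw [Measure.setLIntegral_rnDeriv hQ.absCont]
  exact (Measure.setLIntegral_rnDeriv_le s).trans (hPQ s)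

lemma HasLpDensity.densityNorm_le_of_le (hα : 0 < α) (hQ : HasLpDensity α μ Q) (hPQ : P ≤ Q) :
    densityNorm α μ P ≤ densityNorm α μ Q := by
  refine ENNReal.rpow_le_rpow (lintegral_mono_ae ?_) (inv_nonneg.2 hα.le)
  filter_upwards [hQ.rnDeriv_ae_le_of_le hPQ] with x hx using ENNReal.rpow_le_rpow hx hα.le

lemma HasLpDensity.of_le (hα : 0 < α) (hQ : HasLpDensity α μ Q) (hP0 : P ≠ 0) (hPQ : P ≤ Q) :
    HasLpDensity α μ P := by
  have := hQ.isFinite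
  refine ⟨isFiniteMeasure_of_le Q hPQ, hP0, hPQ.absolutelyContinuous.trans hQ.absCont, ?_⟩
  refine (lintegral_mono_ae ?_).trans_lt hQ.lintegral_lt_top
  filter_upwards [hQ.rnDeriv_ae_le_of_le hPQ] with x hx using ENNReal.rpow_le_rpow hx hα.le

lemma HasLpDensity.rnDeriv_add_smul (hP : HasLpDensity α μ P) (hQ : HasLpDensity α μ Q)
    (t : ℝ≥0) :
    (Q + t • P).rnDeriv μ =ᵐ[μ] fun x => Q.rnDeriv μ x + t * P.rnDeriv μ x := by
  have := hP.isFinite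
  have := hQ.isFinite
  filter_upwards [Measure.rnDeriv_add' Q (t • P) μ, Measure.rnDeriv_smul_left P μ t]
    with x hadd hsmul
  rw [hadd, Pi.add_apply, hsmul]
  rfl

lemma normalizedCrossIntegral_le_iff (hα : 0 < α) (hP : HasLpDensity α μ P)
    (hQ : HasLpDensity α μ Q) (hR : HasLpDensity α μ R) :
    normalizedCrossIntegral α μ P R ≤ normalizedCrossIntegral α μ Q R ↔
      crossIntegral α μ P R * densityNorm α μ Q ≤ crossIntegral α μ Q R * densityNorm α μ P := by
  have hr0 := right_ne_zero_of_mul (densityNorm_mul_rpow_ne_zero hα hQ hR)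
  have hrt : densityNorm α μ R ^ (α - 1) ≠ ⊤ :=
    ENNReal.rpow_ne_top_of_ne_zero (hR.densityNorm_ne_zero hα) (hR.densityNorm_ne_top hα)
  rw [normalizedCrossIntegral, normalizedCrossIntegral,
    ENNReal.div_le_iff (densityNorm_mul_rpow_ne_zero hα hP hR)
      (densityNorm_mul_rpow_ne_top hα hP hR), ENNReal.mul_comm_div,
    ENNReal.mul_div_mul_right _ _ hr0 hrt, ← mul_div_assoc,
    ENNReal.le_div_iff_mul_le (.inl (hQ.densityNorm_ne_zero hα)) (.inl (hQ.densityNorm_ne_top hα))]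

lemma mul_crossIntegral_add_smul_le (hα : 0 < α) (hα1 : α < 1) (ht : t ≠ 0)
    (hP : HasLpDensity α μ P) (hQ : HasLpDensity α μ Q) (hR : HasLpDensity α μ R)
    (hQR : crossIntegral α μ Q R ≠ ⊤)
    (h : normalizedCrossIntegral α μ Q R ≤ normalizedCrossIntegral α μ (Q + t • P) R) :
    crossIntegral α μ Q R * crossIntegral α μ P (Q + t • P)
      ≤ densityNorm α μ Q ^ α * crossIntegral α μ P R := by
  set M := Q + t • P with hM_def
  have hM : HasLpDensity α μ M := hQ.add hα (hP.smul hα ht)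
  have hself : densityNorm α μ Q * densityNorm α μ M ^ (α - 1) + t * crossIntegral α μ P M
      ≤ densityNorm α μ M * densityNorm α μ M ^ (α - 1) := by
    rw [densityNorm_mul_rpow_sub_one hα hM, ← crossIntegral_self hα hM]
    nth_rw 4 [hM_def]
    rw [crossIntegral_add_left, crossIntegral_smul_left]
    gcongr
    exact densityNorm_mul_rpow_le_crossIntegral hα hα1 hQ hM
  have hnorm : densityNorm α μ M ^ (α - 1) ≤ densityNorm α μ Q ^ (α - 1) :=
    (rpow_le_rpow_iff_of_neg (sub_neg.2 hα1)).2
      (hM.densityNorm_le_of_le hα (Measure.le_add_right le_rfl))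
  rw [normalizedCrossIntegral_le_iff hα hQ hM hR, hM_def, crossIntegral_add_left,
    crossIntegral_smul_left, ← hM_def] at h
  rw [← densityNorm_mul_rpow_sub_one hα hQ]
  generalize crossIntegral α μ Q R = A at *
  generalize crossIntegral α μ P R = B at *
  generalize crossIntegral α μ P M = K at *
  have hm := densityNorm_mul_rpow_ne_top hα hQ hM
  have hcancel : A * (densityNorm α μ Q * densityNorm α μ M ^ (α - 1)) + t * (A * K)
      ≤ A * (densityNorm α μ Q * densityNorm α μ M ^ (α - 1))
        + t * (densityNorm α μ Q * densityNorm α μ M ^ (α - 1) * B) := by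
    calc _ = A * (densityNorm α μ Q * densityNorm α μ M ^ (α - 1) + t * K) := by ring
      _ ≤ A * (densityNorm α μ M * densityNorm α μ M ^ (α - 1)) := by gcongr
      _ = A * densityNorm α μ M * densityNorm α μ M ^ (α - 1) := by ring
      _ ≤ (A + t * B) * densityNorm α μ Q * densityNorm α μ M ^ (α - 1) := by gcongr
      _ = _ := by ring
  rw [ENNReal.add_le_add_iff_left (ENNReal.mul_ne_top hQR hm),
    ENNReal.mul_le_mul_iff_right (by simpa using ht) ENNReal.coe_ne_top] at hcancel
  exact hcancel.trans (by gcongr)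

lemma le_mul_crossIntegral_add_smul (hα1 : 1 < α) (ht : t ≠ 0)
    (hP : HasLpDensity α μ P) (hQ : HasLpDensity α μ Q) (hR : HasLpDensity α μ R)
    (h : normalizedCrossIntegral α μ (Q + t • P) R ≤ normalizedCrossIntegral α μ Q R) :
    densityNorm α μ Q ^ α * crossIntegral α μ P R
      ≤ crossIntegral α μ Q R * crossIntegral α μ P (Q + t • P) := by
  have hα : 0 < α := zero_lt_one.trans hα1
  set M := Q + t • P with hM_def
  have hM : HasLpDensity α μ M := hQ.add hα (hP.smul hα ht)
  have hself : densityNorm α μ M * densityNorm α μ M ^ (α - 1)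
      ≤ densityNorm α μ Q * densityNorm α μ M ^ (α - 1) + t * crossIntegral α μ P M := by
    rw [densityNorm_mul_rpow_sub_one hα hM, ← crossIntegral_self hα hM]
    nth_rw 1 [hM_def]
    rw [crossIntegral_add_left, crossIntegral_smul_left]
    gcongr
    exact crossIntegral_le_densityNorm_mul_rpow hα1 hQ hM
  have hnorm : densityNorm α μ Q ^ (α - 1) ≤ densityNorm α μ M ^ (α - 1) :=
    ENNReal.rpow_le_rpow (hM.densityNorm_le_of_le hα (Measure.le_add_right le_rfl))
      (sub_nonneg.2 hα1.le)
  have hQR : crossIntegral α μ Q R ≠ ⊤ := ne_top_of_le_ne_top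
    (densityNorm_mul_rpow_ne_top hα hQ hR) (crossIntegral_le_densityNorm_mul_rpow hα1 hQ hR)
  rw [normalizedCrossIntegral_le_iff hα hM hQ hR, hM_def, crossIntegral_add_left,
    crossIntegral_smul_left, ← hM_def] at h
  rw [← densityNorm_mul_rpow_sub_one hα hQ]
  generalize crossIntegral α μ Q R = A at *
  generalize crossIntegral α μ P R = B at *
  generalize crossIntegral α μ P M = K at *
  have hm := densityNorm_mul_rpow_ne_top hα hQ hM
  have hcancel : A * (densityNorm α μ Q * densityNorm α μ M ^ (α - 1))
        + t * (densityNorm α μ Q * densityNorm α μ M ^ (α - 1) * B)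
      ≤ A * (densityNorm α μ Q * densityNorm α μ M ^ (α - 1)) + t * (A * K) := by
    calc _ = (A + t * B) * densityNorm α μ Q * densityNorm α μ M ^ (α - 1) := by ring
      _ ≤ A * densityNorm α μ M * densityNorm α μ M ^ (α - 1) := by gcongr
      _ = A * (densityNorm α μ M * densityNorm α μ M ^ (α - 1)) := by ring
      _ ≤ A * (densityNorm α μ Q * densityNorm α μ M ^ (α - 1) + t * K) := by gcongr
      _ = _ := by ring
  rw [ENNReal.add_le_add_iff_left (ENNReal.mul_ne_top hQR hm),
    ENNReal.mul_le_mul_iff_right (by simpa using ht) ENNReal.coe_ne_top] at hcancel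
  exact le_trans (by gcongr) hcancel

end Perturbation

section VariationalInequality

variable {α : ℝ} {P Q R : Measure X}

lemma IsForwardProjection.relEntropy_le {E : Set (Measure X)} (h : IsForwardProjection α μ E R Q)
    (hP : P ∈ E) : relEntropy α μ Q R ≤ relEntropy α μ P R :=
  h.eq_iInf ▸ iInf₂_le P hP

lemma IsForwardProjection.relEntropy_lt_top {E : Set (Measure X)}
    (h : IsForwardProjection α μ E R Q) : relEntropy α μ Q R < ⊤ :=
  let ⟨_, hP, hPR⟩ := h.exists_finite
  (h.relEntropy_le hP).trans_lt hPR

variable [SigmaFinite μ]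

lemma ae_tendsto_rnDeriv_add_smul_rpow (hP : HasLpDensity α μ P) (hQ : HasLpDensity α μ Q)
    {t : ℕ → ℝ≥0} (ht : Tendsto t atTop (𝓝 0)) :
    ∀ᵐ x ∂P, Tendsto (fun n => ((Q + t n • P).rnDeriv μ x) ^ (α - 1)) atTop
      (𝓝 ((Q.rnDeriv μ x) ^ (α - 1))) := by
  filter_upwards [hP.absCont (ae_all_iff.2 fun n => hP.rnDeriv_add_smul hQ (t n)),
    hP.absCont hP.ae_rnDeriv_ne_top] with x hx hPx
  have hlim : Tendsto (fun n => Q.rnDeriv μ x + t n * P.rnDeriv μ x) atTop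
      (𝓝 (Q.rnDeriv μ x)) := by
    simpa using (ENNReal.Tendsto.mul_const (ENNReal.tendsto_coe.2 ht) (.inr hPx)).const_add
      (Q.rnDeriv μ x)
  simp only [hx]
  exact (ENNReal.continuous_rpow_const.tendsto _).comp hlim

lemma crossIntegral_le_of_forall_add_smul (hP : HasLpDensity α μ P) (hQ : HasLpDensity α μ Q)
    {C : ℝ≥0∞} (h : ∀ t : ℝ≥0, t ≠ 0 → crossIntegral α μ P (Q + t • P) ≤ C) :
    crossIntegral α μ P Q ≤ C := by
  have hlim := ae_tendsto_rnDeriv_add_smul_rpow hP hQ tendsto_one_div_add_atTop_nhds_zero_nat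
  calc crossIntegral α μ P Q
      = ∫⁻ x, liminf (fun n : ℕ => ((Q + (1 / (n + 1) : ℝ≥0) • P).rnDeriv μ x) ^ (α - 1)) atTop
          ∂P := lintegral_congr_ae (hlim.mono fun x hx => hx.liminf_eq.symm)
    _ ≤ liminf (fun n : ℕ => crossIntegral α μ P (Q + (1 / (n + 1) : ℝ≥0) • P)) atTop :=
      lintegral_liminf_le fun n => by fun_prop
    _ ≤ C := liminf_le_of_le (by isBoundedDefault) fun b hb =>
      let ⟨n, hn⟩ := hb.exists
      hn.trans (h _ (by positivity))

lemma le_crossIntegral_of_forall_add_smul (hα1 : 1 < α) (hP : HasLpDensity α μ P)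
    (hQ : HasLpDensity α μ Q) {C : ℝ≥0∞}
    (h : ∀ t : ℝ≥0, t ≠ 0 → C ≤ crossIntegral α μ P (Q + t • P)) :
    C ≤ crossIntegral α μ P Q := by
  have hα : 0 < α := zero_lt_one.trans hα1
  have hQP := hQ.add hα hP
  have hbound (n : ℕ) : ∀ᵐ x ∂P, ((Q + (1 / (n + 1) : ℝ≥0) • P).rnDeriv μ x) ^ (α - 1)
      ≤ ((Q + P).rnDeriv μ x) ^ (α - 1) := by
    have hle : Q + (1 / (n + 1) : ℝ≥0) • P ≤ Q + P := by
      have hn : (1 / (n + 1) : ℝ≥0) ≤ 1 := div_le_one_of_le₀ (by simp) (by positivity)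
      gcongr
      exact fun s => mul_le_of_le_one_left' (ENNReal.coe_le_coe.2 hn)
    filter_upwards [hP.absCont (hQP.rnDeriv_ae_le_of_le hle)] with x hx
      using ENNReal.rpow_le_rpow hx (sub_nonneg.2 hα1.le)
  refine ge_of_tendsto' (tendsto_lintegral_of_dominated_convergence _ (fun n => by fun_prop) hbound
    ?_ (ae_tendsto_rnDeriv_add_smul_rpow hP hQ tendsto_one_div_add_atTop_nhds_zero_nat))
    fun n => h _ (by positivity)
  exact ne_top_of_le_ne_top (densityNorm_mul_rpow_ne_top hα hP hQP)
    (crossIntegral_le_densityNorm_mul_rpow hα1 hP hQP)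

variable {Γ : Type*} {f : Γ → X → ℝ}

lemma inv_smul_add_smul_mem_linearFamily (hα : 0 < α) (hQ : Q ∈ linearFamily α μ f)
    (hP : P ∈ linearFamily α μ f) {t : ℝ≥0} (ht : t ≠ 0) :
    (1 + t)⁻¹ • (Q + t • P) ∈ linearFamily α μ f := by
  have := hQ.1.isProb
  have := hP.1.isProb
  have hM := (hQ.1.hasLpDensity.add hα (hP.1.hasLpDensity.smul hα ht)).smul hα
    (t := (1 + t)⁻¹) (by positivity)
  refine ⟨⟨⟨?_⟩, hM.absCont, hM.lintegral_lt_top⟩, fun γ => ⟨?_, ?_⟩⟩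
  · rw [Measure.smul_apply, Measure.add_apply, Measure.smul_apply, measure_univ, measure_univ,
      ENNReal.smul_def, ENNReal.smul_def, smul_eq_mul, smul_eq_mul, mul_one,
      ENNReal.coe_inv (by positivity)]
    push_cast
    exact ENNReal.inv_mul_cancel (by simp) (by simp)
  · exact ((hQ.2 γ).1.add_measure ((hP.2 γ).1.smul_measure_nnreal)).smul_measure_nnreal
  · rw [integral_smul_nnreal_measure, integral_add_measure (hQ.2 γ).1
      (hP.2 γ).1.smul_measure_nnreal, integral_smul_nnreal_measure, (hQ.2 γ).2, (hP.2 γ).2]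
    simp

lemma crossIntegral_ne_zero_of_relEntropy_lt_top (hα : 0 < α) (hα1 : α ≠ 1)
    (hP : HasLpDensity α μ P) (hQ : HasLpDensity α μ Q) (h : relEntropy α μ P Q < ⊤) :
    crossIntegral α μ P Q ≠ 0 := by
  rcases hα1.lt_or_gt with hlt | hgt
  · exact ((pos_iff_ne_zero.2 (densityNorm_mul_rpow_ne_zero hα hP hQ)).trans_le
      (densityNorm_mul_rpow_le_crossIntegral hα hlt hP hQ)).ne'
  · exact (relEntropy_lt_top_iff_of_one_lt hgt hP hQ).1 h

lemma crossIntegral_ne_top_of_relEntropy_lt_top (hα : 0 < α) (hα1 : α ≠ 1)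
    (hP : HasLpDensity α μ P) (hQ : HasLpDensity α μ Q) (h : relEntropy α μ P Q < ⊤) :
    crossIntegral α μ P Q ≠ ⊤ := by
  rcases hα1.lt_or_gt with hlt | hgt
  · exact (relEntropy_lt_top_iff_of_lt_one hα hlt hP hQ).1 h
  · exact ne_top_of_le_ne_top (densityNorm_mul_rpow_ne_top hα hP hQ)
      (crossIntegral_le_densityNorm_mul_rpow hgt hP hQ)

lemma IsForwardProjection.mul_crossIntegral_le (hα : 0 < α) (hα1 : α < 1)
    (hR : HasLpDensity α μ R) (h : IsForwardProjection α μ (linearFamily α μ f) R Q)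
    (hP : P ∈ linearFamily α μ f) :
    crossIntegral α μ Q R * crossIntegral α μ P Q
      ≤ densityNorm α μ Q ^ α * crossIntegral α μ P R := by
  have hQd := h.mem.1.hasLpDensity
  have hPd := hP.1.hasLpDensity
  have hA0 := crossIntegral_ne_zero_of_relEntropy_lt_top hα hα1.ne hQd hR h.relEntropy_lt_top
  have hA := crossIntegral_ne_top_of_relEntropy_lt_top hα hα1.ne hQd hR h.relEntropy_lt_top
  rw [mul_comm, ← ENNReal.le_div_iff_mul_le (.inl hA0) (.inl hA)]
  refine crossIntegral_le_of_forall_add_smul hPd hQd fun t ht => ?_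
  rw [ENNReal.le_div_iff_mul_le (.inl hA0) (.inl hA), mul_comm]
  refine mul_crossIntegral_add_smul_le hα hα1 ht hPd hQd hR hA ?_
  have hM := inv_smul_add_smul_mem_linearFamily hα h.mem hP ht
  rw [← normalizedCrossIntegral_smul_left hα (inv_ne_zero (by positivity : 1 + t ≠ 0))
    (hQd.add hα (hPd.smul hα ht)),
    ← relEntropy_le_iff_of_lt_one hα hα1 hQd hR hM.1.hasLpDensity hR]
  exact h.relEntropy_le hM

lemma IsForwardProjection.le_mul_crossIntegral (hα1 : 1 < α)
    (hR : HasLpDensity α μ R) (h : IsForwardProjection α μ (linearFamily α μ f) R Q)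
    (hP : P ∈ linearFamily α μ f) :
    densityNorm α μ Q ^ α * crossIntegral α μ P R
      ≤ crossIntegral α μ Q R * crossIntegral α μ P Q := by
  have hα : 0 < α := zero_lt_one.trans hα1
  have hQd := h.mem.1.hasLpDensity
  have hPd := hP.1.hasLpDensity
  have hA0 := crossIntegral_ne_zero_of_relEntropy_lt_top hα hα1.ne' hQd hR h.relEntropy_lt_top
  have hA := crossIntegral_ne_top_of_relEntropy_lt_top hα hα1.ne' hQd hR h.relEntropy_lt_top
  rw [← ENNReal.div_le_iff' hA0 hA]
  refine le_crossIntegral_of_forall_add_smul hα1 hPd hQd fun t ht => ?_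
  rw [ENNReal.div_le_iff' hA0 hA]
  refine le_mul_crossIntegral_add_smul hα1 ht hPd hQd hR ?_
  have hM := inv_smul_add_smul_mem_linearFamily hα h.mem hP ht
  rw [← normalizedCrossIntegral_smul_left hα (inv_ne_zero (by positivity : 1 + t ≠ 0))
    (hQd.add hα (hPd.smul hα ht)),
    ← relEntropy_le_iff_of_one_lt hα1 hQd hR hM.1.hasLpDensity hR]
  exact h.relEntropy_le hM

lemma IsForwardProjection.crossIntegral_self_ne_top (hα : 0 < α) (hα1 : α ≠ 1)
    (hR : HasLpDensity α μ R) (h : IsForwardProjection α μ (linearFamily α μ f) R Q)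
    (hP : P ∈ linearFamily α μ f) (hPR : relEntropy α μ P R < ⊤) :
    crossIntegral α μ P Q ≠ ⊤ := by
  have hQd := h.mem.1.hasLpDensity
  have hPd := hP.1.hasLpDensity
  rcases hα1.lt_or_gt with hlt | hgt
  · intro htop
    have hle := h.mul_crossIntegral_le hα hlt hR hP
    rw [htop, ENNReal.mul_top
      (crossIntegral_ne_zero_of_relEntropy_lt_top hα hα1 hQd hR h.relEntropy_lt_top),
      top_le_iff] at hle
    exact ENNReal.mul_ne_top (ENNReal.rpow_ne_top_of_nonneg hα.le (hQd.densityNorm_ne_top hα))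
      (crossIntegral_ne_top_of_relEntropy_lt_top hα hα1 hPd hR hPR) hle
  · exact ne_top_of_le_ne_top (densityNorm_mul_rpow_ne_top hα hPd hQd)
      (crossIntegral_le_densityNorm_mul_rpow hgt hPd hQd)

end VariationalInequality

section PowerLaw

variable {α : ℝ} {P Q R : Measure X}

/-- The constant `∫ q ^ α dμ / ∫ q r ^ (α - 1) dμ` in the power law of a forward projection. -/
def powerLawConst (α : ℝ) (μ Q R : Measure X) : ℝ :=
  ((∫⁻ x, (Q.rnDeriv μ x) ^ α ∂μ) / crossIntegral α μ Q R).toReal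

/-- The deviation `q ^ (α - 1) - c r ^ (α - 1)` from proportionality, `c` being `powerLawConst`,
with infinite powers replaced by `0`. -/
def powerLawFun (α : ℝ) (μ Q R : Measure X) (x : X) : ℝ :=
  ((Q.rnDeriv μ x) ^ (α - 1)).toReal - powerLawConst α μ Q R * ((R.rnDeriv μ x) ^ (α - 1)).toReal

lemma measurableSet_rnDeriv_eq_zero : MeasurableSet {x | Q.rnDeriv μ x = 0} :=
  measurableSet_eq_fun (by fun_prop) measurable_const

lemma integrable_toReal_rnDeriv_rpow (h : crossIntegral α μ P Q ≠ ⊤) :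
    Integrable (fun x => ((Q.rnDeriv μ x) ^ (α - 1)).toReal) P :=
  integrable_toReal_of_lintegral_ne_top (by fun_prop) h

lemma integral_toReal_rnDeriv_rpow (h : crossIntegral α μ P Q ≠ ⊤) :
    ∫ x, ((Q.rnDeriv μ x) ^ (α - 1)).toReal ∂P = (crossIntegral α μ P Q).toReal :=
  integral_toReal (by fun_prop) (ae_lt_top (by fun_prop) h)

lemma integrable_powerLawFun (hPQ : crossIntegral α μ P Q ≠ ⊤) (hPR : crossIntegral α μ P R ≠ ⊤) :
    Integrable (powerLawFun α μ Q R) P :=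
  (integrable_toReal_rnDeriv_rpow hPQ).sub ((integrable_toReal_rnDeriv_rpow hPR).const_mul _)

lemma integral_powerLawFun (hPQ : crossIntegral α μ P Q ≠ ⊤) (hPR : crossIntegral α μ P R ≠ ⊤) :
    ∫ x, powerLawFun α μ Q R x ∂P = (crossIntegral α μ P Q).toReal -
      powerLawConst α μ Q R * (crossIntegral α μ P R).toReal := by
  simp only [powerLawFun]
  rw [integral_sub (integrable_toReal_rnDeriv_rpow hPQ)
    ((integrable_toReal_rnDeriv_rpow hPR).const_mul _), integral_const_mul,
    integral_toReal_rnDeriv_rpow hPQ, integral_toReal_rnDeriv_rpow hPR]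

lemma setIntegral_powerLawFun_of_rnDeriv_eq_zero (hα1 : 1 < α) (hPR : crossIntegral α μ P R ≠ ⊤) :
    ∫ x in {x | Q.rnDeriv μ x = 0}, powerLawFun α μ Q R x ∂P =
      -(powerLawConst α μ Q R *
        (∫⁻ x in {x | Q.rnDeriv μ x = 0}, (R.rnDeriv μ x) ^ (α - 1) ∂P).toReal) := by
  rw [← integral_toReal (by fun_prop) (ae_restrict_of_ae (ae_lt_top (by fun_prop) hPR)),
    ← integral_const_mul, ← integral_neg]
  refine setIntegral_congr_fun measurableSet_rnDeriv_eq_zero fun x (hx : Q.rnDeriv μ x = 0) => ?_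
  simp [powerLawFun, hx, hα1]

lemma measure_rnDeriv_eq_zero (hα1 : α < 1) (hPQ : crossIntegral α μ P Q ≠ ⊤) :
    P {x | Q.rnDeriv μ x = 0} = 0 := by
  rw [measure_eq_zero_iff_ae_notMem]
  filter_upwards [ae_lt_top (by fun_prop) hPQ] with x hx (hx0 : Q.rnDeriv μ x = 0)
  rw [hx0, ENNReal.zero_rpow_of_neg (sub_neg.2 hα1)] at hx
  exact hx.ne rfl

variable [SigmaFinite μ]

lemma hasPowerLawForm_powerLawFun (hQ : HasLpDensity α μ Q) (hQR : crossIntegral α μ Q R ≠ ⊤) :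
    HasPowerLawForm α μ Q R (powerLawConst α μ Q R) (powerLawFun α μ Q R)
      {x | Q.rnDeriv μ x = 0} := by
  rw [crossIntegral_eq_lintegral_mul hQ] at hQR
  filter_upwards [hQ.ae_rnDeriv_ne_top, ae_lt_top (by fun_prop) hQR] with x hq hqr
  refine ⟨fun (hq0 : Q.rnDeriv μ x ≠ 0) => ?_, id⟩
  have hqt : Q.rnDeriv μ x ^ (α - 1) ≠ ⊤ := ENNReal.rpow_ne_top_of_ne_zero hq0 hq
  have hrt : R.rnDeriv μ x ^ (α - 1) ≠ ⊤ := fun hrt => by simp [hrt, hq0] at hqr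
  rw [powerLawFun, ← EReal.coe_ennreal_toReal hqt, ← EReal.coe_ennreal_toReal hrt]
  norm_cast
  ring

variable {Γ : Type*} {f : Γ → X → ℝ}

lemma IsForwardProjection.integral_powerLawFun_nonpos (hα : 0 < α) (hα1 : α < 1)
    (hR : HasLpDensity α μ R) (h : IsForwardProjection α μ (linearFamily α μ f) R Q)
    (hP : P ∈ linearFamily α μ f) (hPR : relEntropy α μ P R < ⊤) :
    ∫ x, powerLawFun α μ Q R x ∂P ≤ 0 := by
  have hQ := h.mem.1.hasLpDensity
  have hPR' := crossIntegral_ne_top_of_relEntropy_lt_top hα hα1.ne hP.1.hasLpDensity hR hPR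
  have hQR := ENNReal.toReal_pos
    (crossIntegral_ne_zero_of_relEntropy_lt_top hα hα1.ne hQ hR h.relEntropy_lt_top)
    (crossIntegral_ne_top_of_relEntropy_lt_top hα hα1.ne hQ hR h.relEntropy_lt_top)
  have hle := h.mul_crossIntegral_le hα hα1 hR hP
  rw [densityNorm_rpow hα.ne'] at hle
  have hle := ENNReal.toReal_mono (ENNReal.mul_ne_top hQ.lintegral_lt_top.ne hPR') hle
  rw [ENNReal.toReal_mul, ENNReal.toReal_mul] at hle
  rw [integral_powerLawFun (h.crossIntegral_self_ne_top hα hα1.ne hR hP hPR) hPR', powerLawConst,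
    ENNReal.toReal_div, sub_nonpos, div_mul_eq_mul_div, le_div_iff₀' hQR]
  exact hle

lemma IsForwardProjection.integral_powerLawFun_nonneg (hα1 : 1 < α)
    (hR : HasLpDensity α μ R) (h : IsForwardProjection α μ (linearFamily α μ f) R Q)
    (hP : P ∈ linearFamily α μ f) (hPR : relEntropy α μ P R < ⊤) :
    0 ≤ ∫ x, powerLawFun α μ Q R x ∂P := by
  have hα : 0 < α := zero_lt_one.trans hα1
  have hQ := h.mem.1.hasLpDensity
  have hPR' := crossIntegral_ne_top_of_relEntropy_lt_top hα hα1.ne' hP.1.hasLpDensity hR hPR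
  have hPQ := h.crossIntegral_self_ne_top hα hα1.ne' hR hP hPR
  have hQRt := crossIntegral_ne_top_of_relEntropy_lt_top hα hα1.ne' hQ hR h.relEntropy_lt_top
  have hQR := ENNReal.toReal_pos
    (crossIntegral_ne_zero_of_relEntropy_lt_top hα hα1.ne' hQ hR h.relEntropy_lt_top) hQRt
  have hle := h.le_mul_crossIntegral hα1 hR hP
  rw [densityNorm_rpow hα.ne'] at hle
  have hle := ENNReal.toReal_mono (ENNReal.mul_ne_top hQRt hPQ) hle
  rw [ENNReal.toReal_mul, ENNReal.toReal_mul] at hle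
  rw [integral_powerLawFun hPQ hPR', powerLawConst,
    ENNReal.toReal_div, sub_nonneg, div_mul_eq_mul_div, div_le_iff₀' hQR]
  exact hle

lemma integrable_powerLawFun_self (hα : 0 < α) (hQ : HasLpDensity α μ Q)
    (hQR : crossIntegral α μ Q R ≠ ⊤) : Integrable (powerLawFun α μ Q R) Q :=
  integrable_powerLawFun (hQ.crossIntegral_self_ne_top hα) hQR

lemma integral_powerLawFun_self (hα : 0 < α) (hQ : HasLpDensity α μ Q)
    (hQR0 : crossIntegral α μ Q R ≠ 0) (hQR : crossIntegral α μ Q R ≠ ⊤) :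
    ∫ x, powerLawFun α μ Q R x ∂Q = 0 := by
  rw [integral_powerLawFun (hQ.crossIntegral_self_ne_top hα) hQR, crossIntegral_self hα hQ,
    densityNorm_rpow hα.ne', powerLawConst, ENNReal.toReal_div,
    div_mul_cancel₀ _ (ENNReal.toReal_pos hQR0 hQR).ne', sub_self]

lemma IsForwardProjection.sideCondition (hα : 0 < α) (hα1 : α ≠ 1) (hR : HasLpDensity α μ R)
    (h : IsForwardProjection α μ (linearFamily α μ f) R Q) :
    SideCondition α μ (linearFamily α μ f) R (powerLawConst α μ Q R) (powerLawFun α μ Q R)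
      {x | Q.rnDeriv μ x = 0} := by
  intro P hP hPR
  have hPQ := h.crossIntegral_self_ne_top hα hα1 hR hP hPR
  have hPR' := crossIntegral_ne_top_of_relEntropy_lt_top hα hα1 hP.1.hasLpDensity hR hPR
  have hg := integrable_powerLawFun hPQ hPR'
  refine ⟨fun hlt => measure_rnDeriv_eq_zero hlt hPQ, fun hgt => ⟨hg.integrableOn, ?_⟩⟩
  have hnonneg := h.integral_powerLawFun_nonneg hgt hR hP hPR
  rw [← integral_add_compl measurableSet_rnDeriv_eq_zero hg,
    setIntegral_powerLawFun_of_rnDeriv_eq_zero hgt hPR', neg_add_eq_sub, sub_nonneg] at hnonneg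
  have hN : ∫⁻ x in {x | Q.rnDeriv μ x = 0}, (R.rnDeriv μ x) ^ (α - 1) ∂P ≠ ⊤ :=
    ne_top_of_le_ne_top hPR' (setLIntegral_le_lintegral _ _)
  rw [← EReal.coe_ennreal_toReal hN]
  exact_mod_cast hnonneg

end PowerLaw

section LOneDual

lemma ae_norm_le_norm_of_Lp_top (k : Lp ℝ ∞ μ) : ∀ᵐ x ∂μ, ‖k x‖ ≤ ‖k‖ := by
  filter_upwards [ae_le_eLpNormEssSup (f := k) (μ := μ)] with x hx
  rw [← eLpNorm_exponent_top, ← Lp.enorm_def] at hx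
  exact enorm_le_iff_norm_le.1 hx

lemma lpPairing_mul_toL1 (k : Lp ℝ ∞ μ) {v : X → ℝ} (hv : Integrable v μ) :
    (ContinuousLinearMap.mul ℝ ℝ).lpPairing μ ∞ 1 k (hv.toL1 v) = ∫ x, k x * v x ∂μ := by
  rw [ContinuousLinearMap.lpPairing_eq_integral]
  refine integral_congr_ae ?_
  filter_upwards [hv.coeFn_toL1] with x hx
  rw [hx, ContinuousLinearMap.mul_apply']

lemma ae_abs_le_of_forall_abs_setIntegral_le [IsFiniteMeasure μ] {h : X → ℝ} {C : ℝ}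
    (hh : Integrable h μ) (hC : ∀ s, MeasurableSet s → |∫ x in s, h x ∂μ| ≤ C * μ.real s) :
    ∀ᵐ x ∂μ, |h x| ≤ C := by
  have hub : ∀ᵐ x ∂μ, h x ≤ C :=
    ae_le_of_forall_setIntegral_le hh (integrable_const _) fun s hs _ => by
      simpa [mul_comm] using (le_abs_self _).trans (hC s hs)
  have hlb : ∀ᵐ x ∂μ, -C ≤ h x :=
    ae_le_of_forall_setIntegral_le (integrable_const _) hh fun s hs _ => by
      simpa [mul_comm] using (abs_le.1 (hC s hs)).1
  filter_upwards [hlb, hub] with x hx hx' using abs_le.2 ⟨hx, hx'⟩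

/-- Riesz representation in `L²`, applied after multiplication by `1 ∈ L²`, which maps `L²` into
`L¹`. -/
lemma exists_Lp_two_apply_indicatorConstLp [IsFiniteMeasure μ] (φ : StrongDual ℝ (Lp ℝ 1 μ)) :
    ∃ h : Lp ℝ 2 μ, ∀ (s : Set X) (hs : MeasurableSet s) (c : ℝ),
      φ (indicatorConstLp 1 hs (measure_ne_top μ s) c) = c * ∫ x in s, h x ∂μ := by
  let ι : Lp ℝ 2 μ →L[ℝ] Lp ℝ 1 μ := (ContinuousLinearMap.mul ℝ ℝ).holderL μ 2 2 1
    (indicatorConstLp 2 .univ (measure_ne_top μ _) 1)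
  have hι : ∀ (s : Set X) (hs : MeasurableSet s) (c : ℝ),
      ι (indicatorConstLp 2 hs (measure_ne_top μ s) c) =
        indicatorConstLp 1 hs (measure_ne_top μ s) c := fun s hs c => by
    refine Lp.ext ((ContinuousLinearMap.coeFn_holder _ _ _).trans ?_)
    filter_upwards [indicatorConstLp_coeFn (p := 2) (hs := hs) (hμs := measure_ne_top μ s) (c := c),
      indicatorConstLp_coeFn (p := 1) (hs := hs) (hμs := measure_ne_top μ s) (c := c),
      indicatorConstLp_coeFn (p := 2) (hs := .univ) (hμs := measure_ne_top μ .univ) (c := (1 : ℝ))]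
      with x hx₂ hx₁ hx
    rw [hx, hx₁, hx₂]
    simp
  refine ⟨(InnerProductSpace.toDual ℝ _).symm (φ ∘L ι), fun s hs c => ?_⟩
  rw [← hι, ← ContinuousLinearMap.comp_apply, ← InnerProductSpace.toDual_symm_apply (𝕜 := ℝ),
    real_inner_comm, L2.inner_indicatorConstLp_eq_inner_setIntegral, real_inner_comm]
  rfl

lemma exists_eq_lpPairing_mul [IsFiniteMeasure μ] (φ : StrongDual ℝ (Lp ℝ 1 μ)) :
    ∃ k : Lp ℝ ∞ μ, φ = (ContinuousLinearMap.mul ℝ ℝ).lpPairing μ ∞ 1 k := by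
  obtain ⟨h, hφ⟩ := exists_Lp_two_apply_indicatorConstLp φ
  have hbound : ∀ᵐ x ∂μ, ‖h x‖ ≤ ‖φ‖ := by
    refine ae_abs_le_of_forall_abs_setIntegral_le ((Lp.memLp h).integrable one_le_two)
      fun s hs => ?_
    have hle := φ.le_opNorm (indicatorConstLp 1 hs (measure_ne_top μ s) (1 : ℝ))
    rw [hφ s hs, one_mul, norm_indicatorConstLp one_ne_zero ENNReal.one_ne_top] at hle
    simpa using hle
  have hh : MemLp h ∞ μ := memLp_top_of_bound (Lp.aestronglyMeasurable h) _ hbound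
  refine ⟨hh.toLp h, ContinuousLinearMap.ext fun u => ?_⟩
  refine Lp.induction ENNReal.one_ne_top (motive := fun u => φ u =
    (ContinuousLinearMap.mul ℝ ℝ).lpPairing μ ∞ 1 (hh.toLp h) u) (fun c s hs hμs => ?_)
    (fun u v _ _ _ hu hv => by rw [map_add, map_add, hu, hv])
    (isClosed_eq φ.continuous (ContinuousLinearMap.continuous _)) u
  rw [Lp.simpleFunc.coe_indicatorConst, hφ s hs, ContinuousLinearMap.lpPairing_eq_integral,
    ← integral_const_mul, ← integral_indicator hs]
  refine integral_congr_ae ?_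
  filter_upwards [hh.coeFn_toLp,
    indicatorConstLp_coeFn (p := 1) (hs := hs) (hμs := hμs.ne) (c := c)] with x hx hxs
  rw [hx, hxs, ContinuousLinearMap.mul_apply']
  by_cases hxs : x ∈ s <;> simp [hxs, mul_comm]

lemma mem_closure_span_of_forall_dual {E : Type*} [AddCommGroup E] [Module ℝ E]
    [TopologicalSpace E] [IsTopologicalAddGroup E] [ContinuousSMul ℝ E] [LocallyConvexSpace ℝ E]
    {s : Set E} {x : E} (h : ∀ φ : StrongDual ℝ E, (∀ y ∈ s, φ y = 0) → φ x = 0) :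
    x ∈ closure (Submodule.span ℝ s : Set E) := by
  by_contra hx
  obtain ⟨φ, a, ha, hax⟩ := geometric_hahn_banach_closed_point
    (Submodule.span ℝ s).convex.closure isClosed_closure hx
  have ha0 : 0 < a := by simpa using ha 0 (subset_closure (Submodule.zero_mem _))
  have hφ : ∀ y ∈ s, φ y = 0 := fun y hy => by
    by_contra hne
    have hlt := ha ((a / φ y) • y)
      (subset_closure (Submodule.smul_mem _ _ (Submodule.subset_span hy)))
    rw [map_smul, smul_eq_mul, div_mul_cancel₀ _ hne] at hlt
    exact hlt.false
  exact (ha0.trans hax).ne' (h φ hφ)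

variable {Γ : Type*} {f : Γ → X → ℝ}

lemma exists_mem_span_ae_eq_of_mem_span_toL1 (hf : ∀ γ, Integrable (f γ) μ) {u : Lp ℝ 1 μ}
    (hu : u ∈ Submodule.span ℝ (Set.range fun γ => (hf γ).toL1 (f γ))) :
    ∃ v ∈ Submodule.span ℝ (Set.range f), u =ᵐ[μ] v := by
  induction hu using Submodule.span_induction with
  | mem u hu =>
    obtain ⟨γ, rfl⟩ := hu
    exact ⟨f γ, Submodule.subset_span ⟨γ, rfl⟩, (hf γ).coeFn_toL1⟩
  | zero => exact ⟨0, Submodule.zero_mem _, Lp.coeFn_zero _ _ _⟩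
  | add u₁ u₂ _ _ h₁ h₂ =>
    obtain ⟨v₁, hv₁, huv₁⟩ := h₁
    obtain ⟨v₂, hv₂, huv₂⟩ := h₂
    exact ⟨v₁ + v₂, add_mem hv₁ hv₂, (Lp.coeFn_add u₁ u₂).trans (huv₁.add huv₂)⟩
  | smul c u _ h =>
    obtain ⟨v, hv, huv⟩ := h
    exact ⟨c • v, Submodule.smul_mem _ c hv, (Lp.coeFn_smul c u).trans (huv.const_smul c)⟩

lemma inL1ClosureSpan_of_forall_Lp_top [IsFiniteMeasure μ] (hf : ∀ γ, Integrable (f γ) μ)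
    {g : X → ℝ} (hg : Integrable g μ)
    (h : ∀ k : Lp ℝ ∞ μ, (∀ γ, ∫ x, k x * f γ x ∂μ = 0) → ∫ x, k x * g x ∂μ = 0) :
    InL1ClosureSpan μ f g := by
  refine ⟨memLp_one_iff_integrable.2 hg, fun ε hε => ?_⟩
  have hmem : hg.toL1 g ∈ closure
      (Submodule.span ℝ (Set.range fun γ => (hf γ).toL1 (f γ)) : Set (Lp ℝ 1 μ)) := by
    refine mem_closure_span_of_forall_dual fun φ hφ => ?_
    obtain ⟨k, rfl⟩ := exists_eq_lpPairing_mul φ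
    rw [lpPairing_mul_toL1]
    exact h k fun γ => by rw [← lpPairing_mul_toL1 k (hf γ), hφ _ ⟨γ, rfl⟩]
  obtain ⟨u, hu, hlt⟩ := EMetric.mem_closure_iff.1 hmem ε hε
  obtain ⟨v, hv, huv⟩ := exists_mem_span_ae_eq_of_mem_span_toL1 hf hu
  rw [Lp.edist_def] at hlt
  exact ⟨v, hv, (eLpNorm_congr_ae (hg.coeFn_toL1.symm.sub huv.symm)).trans_lt hlt⟩

end LOneDual

section DensityPerturbation

variable {α : ℝ} {P Q R : Measure X} {k F : X → ℝ}

/-- The measure `(1 + k) dQ`. It is used for `|k| ≤ 1 / 2` and `∫ k dQ = 0`, where it is a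
probability measure comparable with `Q`; elsewhere negative values of `1 + k` are cut off. -/
def perturbation (Q : Measure X) (k : X → ℝ) : Measure X :=
  Q.withDensity fun x => ENNReal.ofReal (1 + k x)

lemma perturbation_le_smul (hk : ∀ᵐ x ∂Q, |k x| ≤ 1 / 2) :
    perturbation Q k ≤ (2 : ℝ≥0) • Q := by
  rw [ENNReal.smul_def, ← withDensity_const]
  refine withDensity_mono ?_
  filter_upwards [hk] with x hx
  refine ENNReal.ofReal_le_of_le_toReal ?_
  norm_num
  linarith [(abs_le.1 hx).2]

lemma le_smul_perturbation (hkm : Measurable k) (hk : ∀ᵐ x ∂Q, |k x| ≤ 1 / 2) :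
    Q ≤ (2 : ℝ≥0) • perturbation Q k := by
  rw [ENNReal.smul_def, perturbation, ← withDensity_smul _ (by fun_prop)]
  conv_lhs => rw [← withDensity_one (μ := Q)]
  refine withDensity_mono ?_
  filter_upwards [hk] with x hx
  rw [Pi.one_apply, Pi.smul_apply, smul_eq_mul, ENNReal.coe_ofNat, ← ENNReal.ofReal_ofNat,
    ← ENNReal.ofReal_mul zero_le_two, ENNReal.one_le_ofReal]
  linarith [(abs_le.1 hx).1]

lemma toReal_ofReal_smul_perturbation_ae_eq (hk : ∀ᵐ x ∂Q, |k x| ≤ 1 / 2) :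
    (fun x => (ENNReal.ofReal (1 + k x)).toReal • F x) =ᵐ[Q] fun x => F x + k x * F x := by
  filter_upwards [hk] with x hx
  rw [ENNReal.toReal_ofReal (by linarith [(abs_le.1 hx).1]), smul_eq_mul]
  ring

lemma integrable_perturbation (hkm : Measurable k) (hk : ∀ᵐ x ∂Q, |k x| ≤ 1 / 2)
    (hF : Integrable F Q) : Integrable F (perturbation Q k) := by
  rw [perturbation, integrable_withDensity_iff_integrable_smul' (by fun_prop)
    (.of_forall fun x => ENNReal.ofReal_lt_top),
    integrable_congr (toReal_ofReal_smul_perturbation_ae_eq hk)]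
  exact hF.add (hF.bdd_mul hkm.aestronglyMeasurable hk)

lemma integral_perturbation (hkm : Measurable k) (hk : ∀ᵐ x ∂Q, |k x| ≤ 1 / 2)
    (hF : Integrable F Q) :
    ∫ x, F x ∂(perturbation Q k) = ∫ x, F x ∂Q + ∫ x, k x * F x ∂Q := by
  rw [perturbation, integral_withDensity_eq_integral_toReal_smul (by fun_prop)
    (.of_forall fun x => ENNReal.ofReal_lt_top),
    integral_congr_ae (toReal_ofReal_smul_perturbation_ae_eq hk),
    integral_add hF (hF.bdd_mul hkm.aestronglyMeasurable hk)]

lemma isProbabilityMeasure_perturbation [IsProbabilityMeasure Q] (hkm : Measurable k)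
    (hk : ∀ᵐ x ∂Q, |k x| ≤ 1 / 2) (hk0 : ∫ x, k x ∂Q = 0) :
    IsProbabilityMeasure (perturbation Q k) := by
  have := isFiniteMeasure_of_le _ (perturbation_le_smul hk)
  have hmass := integral_perturbation hkm hk (integrable_const (1 : ℝ))
  simp only [integral_const, smul_eq_mul, mul_one, probReal_univ, hk0, add_zero] at hmass
  exact isProbabilityMeasure_iff_real.2 hmass

variable [SigmaFinite μ] {Γ : Type*} {f : Γ → X → ℝ}

lemma perturbation_mem_linearFamily (hα : 0 < α) (hQ : Q ∈ linearFamily α μ f)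
    (hkm : Measurable k) (hk : ∀ᵐ x ∂Q, |k x| ≤ 1 / 2) (hk0 : ∫ x, k x ∂Q = 0)
    (hkf : ∀ γ, ∫ x, k x * f γ x ∂Q = 0) : perturbation Q k ∈ linearFamily α μ f := by
  have := hQ.1.isProb
  have hprob := isProbabilityMeasure_perturbation hkm hk hk0
  have hLp := (hQ.1.hasLpDensity.smul hα two_ne_zero).of_le hα hprob.ne_zero
    (perturbation_le_smul hk)
  refine ⟨⟨hprob, hLp.absCont, hLp.lintegral_lt_top⟩, fun γ =>
    ⟨integrable_perturbation hkm hk (hQ.2 γ).1, ?_⟩⟩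
  rw [integral_perturbation hkm hk (hQ.2 γ).1, (hQ.2 γ).2, hkf γ, add_zero]

lemma relEntropy_lt_top_of_le_smul {t : ℝ≥0} (hα : 0 < α) (hα1 : α ≠ 1) (hP : HasLpDensity α μ P)
    (hQ : HasLpDensity α μ Q) (hR : HasLpDensity α μ R) (hPQ : P ≤ t • Q) (hQP : Q ≤ t • P)
    (hQR : relEntropy α μ Q R < ⊤) : relEntropy α μ P R < ⊤ := by
  rcases hα1.lt_or_gt with hlt | hgt
  · rw [relEntropy_lt_top_iff_of_lt_one hα hlt hP hR]
    rw [relEntropy_lt_top_iff_of_lt_one hα hlt hQ hR] at hQR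
    refine ne_top_of_le_ne_top ?_ (lintegral_mono' hPQ le_rfl)
    exact (crossIntegral_smul_left (α := α)).trans_ne (ENNReal.mul_ne_top ENNReal.coe_ne_top hQR)
  · rw [relEntropy_lt_top_iff_of_one_lt hgt hP hR]
    rw [relEntropy_lt_top_iff_of_one_lt hgt hQ hR] at hQR
    refine fun hPR => hQR (le_zero_iff.1 ((lintegral_mono' hQP le_rfl).trans ?_))
    exact (crossIntegral_smul_left.trans (by rw [hPR, mul_zero])).le

variable (hα : 0 < α) (hα1 : α ≠ 1) (hR : HasLpDensity α μ R)
  (h : IsForwardProjection α μ (linearFamily α μ f) R Q)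

include hα hα1 hR h

lemma IsForwardProjection.integrable_powerLawFun_and_integral_eq_zero :
    Integrable (powerLawFun α μ Q R) Q ∧ ∫ x, powerLawFun α μ Q R x ∂Q = 0 := by
  have hQ := h.mem.1.hasLpDensity
  have hQR0 := crossIntegral_ne_zero_of_relEntropy_lt_top hα hα1 hQ hR h.relEntropy_lt_top
  have hQR := crossIntegral_ne_top_of_relEntropy_lt_top hα hα1 hQ hR h.relEntropy_lt_top
  exact ⟨integrable_powerLawFun_self hα hQ hQR, integral_powerLawFun_self hα hQ hQR0 hQR⟩

/-- Perturbing the projection along `k` and along `-k` stays in the linear family, so the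
variational inequality holds with both signs. -/
lemma IsForwardProjection.integral_mul_powerLawFun_eq_zero_of_abs_le (hkm : Measurable k)
    (hk : ∀ᵐ x ∂Q, |k x| ≤ 1 / 2) (hk0 : ∫ x, k x ∂Q = 0) (hkf : ∀ γ, ∫ x, k x * f γ x ∂Q = 0) :
    ∫ x, k x * powerLawFun α μ Q R x ∂Q = 0 := by
  have hQ := h.mem.1.hasLpDensity
  obtain ⟨hg, hg0⟩ := h.integrable_powerLawFun_and_integral_eq_zero hα hα1 hR
  have hpert : ∀ {l : X → ℝ}, Measurable l → (∀ᵐ x ∂Q, |l x| ≤ 1 / 2) → ∫ x, l x ∂Q = 0 →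
      (∀ γ, ∫ x, l x * f γ x ∂Q = 0) →
      (α < 1 → ∫ x, l x * powerLawFun α μ Q R x ∂Q ≤ 0) ∧
        (1 < α → 0 ≤ ∫ x, l x * powerLawFun α μ Q R x ∂Q) := fun {l} hlm hl hl0 hlf => by
    have hmem := perturbation_mem_linearFamily hα h.mem hlm hl hl0 hlf
    have hfin := relEntropy_lt_top_of_le_smul hα hα1 hmem.1.hasLpDensity hQ hR
      (perturbation_le_smul hl) (le_smul_perturbation hlm hl) h.relEntropy_lt_top
    have hint := integral_perturbation hlm hl hg
    rw [hg0, zero_add] at hint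
    exact ⟨fun hlt => hint ▸ h.integral_powerLawFun_nonpos hα hlt hR hmem hfin,
      fun hgt => hint ▸ h.integral_powerLawFun_nonneg hgt hR hmem hfin⟩
  have hplus := hpert hkm hk hk0 hkf
  have hminus := hpert hkm.neg (by simpa using hk) (by simp [integral_neg, hk0])
    (by simpa [integral_neg] using hkf)
  simp only [Pi.neg_apply, neg_mul, integral_neg] at hminus
  rcases hα1.lt_or_gt with hlt | hgt
  · exact le_antisymm (hplus.1 hlt) (neg_nonpos.1 (hminus.1 hlt))
  · exact le_antisymm (neg_nonneg.1 (hminus.2 hgt)) (hplus.2 hgt)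

lemma IsForwardProjection.integral_mul_powerLawFun_eq_zero {C : ℝ} (hkm : Measurable k)
    (hk : ∀ᵐ x ∂Q, |k x| ≤ C) (hkf : ∀ γ, ∫ x, k x * f γ x ∂Q = 0) :
    ∫ x, k x * powerLawFun α μ Q R x ∂Q = 0 := by
  have := h.mem.1.isProb
  obtain ⟨hg, hg0⟩ := h.integrable_powerLawFun_and_integral_eq_zero hα hα1 hR
  have hki : Integrable k Q := .of_bound hkm.aestronglyMeasurable C hk
  set m := ∫ x, k x ∂Q
  set δ := (2 * (|C| + |m| + 1))⁻¹
  have hδ : 0 < δ := by positivity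
  have hint : ∀ {F : X → ℝ}, Integrable F Q → ∫ x, F x ∂Q = 0 →
      ∫ x, δ * (k x - m) * F x ∂Q = δ * ∫ x, k x * F x ∂Q := fun {F} hF hF0 => by
    simp only [mul_assoc, sub_mul]
    rw [integral_const_mul, integral_sub (hF.bdd_mul hkm.aestronglyMeasurable hk)
      (hF.const_mul m), integral_const_mul, hF0, mul_zero, sub_zero]
  have hbound : ∀ᵐ x ∂Q, |δ * (k x - m)| ≤ 1 / 2 := by
    filter_upwards [hk] with x hx
    have hle : |k x - m| ≤ |C| + |m| + 1 := by
      linarith [abs_sub (k x) m, le_abs_self C]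
    rw [abs_mul, abs_of_pos hδ, inv_mul_le_iff₀ (by positivity)]
    linarith
  have hzero := h.integral_mul_powerLawFun_eq_zero_of_abs_le hα hα1 hR
    (k := fun x => δ * (k x - m)) (by fun_prop) hbound
    (by simp [integral_const_mul, integral_sub hki, m])
    fun γ => by rw [hint (h.mem.2 γ).1 (h.mem.2 γ).2, hkf γ, mul_zero]
  rw [hint hg hg0] at hzero
  exact (mul_eq_zero.1 hzero).resolve_left hδ.ne'

lemma IsForwardProjection.inL1ClosureSpan : InL1ClosureSpan Q f (powerLawFun α μ Q R) := by
  have := h.mem.1.isProb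
  refine inL1ClosureSpan_of_forall_Lp_top (fun γ => (h.mem.2 γ).1)
    (h.integrable_powerLawFun_and_integral_eq_zero hα hα1 hR).1 fun k hk => ?_
  exact h.integral_mul_powerLawFun_eq_zero hα hα1 hR (Lp.stronglyMeasurable k).measurable
    (ae_norm_le_norm_of_Lp_top k) hk

end DensityPerturbation

end RelAlpha

end

theorem mainTheorem4 {X : Type*} [MeasurableSpace X] (μ : Measure X) [SigmaFinite μ]
    (α : ℝ) (hα : 0 < α) (hα1 : α ≠ 1)
    {Γ : Type*} (f : Γ → X → ℝ) (hf : ∀ γ, Measurable (f γ))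
    (R : Measure X) (hR : RelAlpha.IsAdmissible α μ R) :
    -- (a)
    (∀ Q : Measure X,
      RelAlpha.IsForwardProjection α μ (RelAlpha.linearFamily α μ f) R Q →
      ∃ (c : ℝ) (g : X → ℝ) (N : Set X),
        MeasurableSet N ∧
        RelAlpha.HasPowerLawForm α μ Q R c g N ∧
        RelAlpha.SideCondition α μ (RelAlpha.linearFamily α μ f) R c g N ∧
        (0 < ∫⁻ x, Q.rnDeriv μ x * (R.rnDeriv μ x) ^ (α - 1) ∂μ ∧
          ∫⁻ x, Q.rnDeriv μ x * (R.rnDeriv μ x) ^ (α - 1) ∂μ < ⊤ ∧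
          c = ((∫⁻ x, (Q.rnDeriv μ x) ^ α ∂μ) /
            ∫⁻ x, Q.rnDeriv μ x * (R.rnDeriv μ x) ^ (α - 1) ∂μ).toReal) ∧
        RelAlpha.InL1ClosureSpan Q f g) ∧
    -- (b)
    (∀ Q ∈ RelAlpha.linearFamily α μ f, ∀ (c : ℝ) (g : X → ℝ) (N : Set X),
      MeasurableSet N →
      g ∈ Submodule.span ℝ (Set.range f) →
      RelAlpha.HasPowerLawForm α μ Q R c g N →
      RelAlpha.SideCondition α μ (RelAlpha.linearFamily α μ f) R c g N →
      (RelAlpha.IsForwardProjection α μ (RelAlpha.linearFamily α μ f) R Q ∧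
        ∀ Q', RelAlpha.IsForwardProjection α μ (RelAlpha.linearFamily α μ f) R Q' → Q' = Q) ∧
      ∀ P ∈ RelAlpha.linearFamily α μ f, RelAlpha.relEntropy α μ P R < ⊤ →
        RelAlpha.relEntropy α μ P Q + RelAlpha.relEntropy α μ Q R ≤ RelAlpha.relEntropy α μ P R ∧
        (α < 1 → RelAlpha.relEntropy α μ P R =
          RelAlpha.relEntropy α μ P Q + RelAlpha.relEntropy α μ Q R)) := by
  refine ⟨fun Q h => ?_, fun Q hQ c g N hN hg hform hside => ?_⟩
  · have hQR := h.relEntropy_lt_top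
    have hQR0 := RelAlpha.crossIntegral_ne_zero_of_relEntropy_lt_top hα hα1
      h.mem.1.hasLpDensity hR.hasLpDensity hQR
    have hQRt := RelAlpha.crossIntegral_ne_top_of_relEntropy_lt_top hα hα1
      h.mem.1.hasLpDensity hR.hasLpDensity hQR
    rw [← RelAlpha.crossIntegral_eq_lintegral_mul h.mem.1.hasLpDensity]
    exact ⟨RelAlpha.powerLawConst α μ Q R, RelAlpha.powerLawFun α μ Q R,
      {x | Q.rnDeriv μ x = 0}, RelAlpha.measurableSet_rnDeriv_eq_zero,
      RelAlpha.hasPowerLawForm_powerLawFun h.mem.1.hasLpDensity hQRt,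
      h.sideCondition hα hα1 hR.hasLpDensity, ⟨pos_iff_ne_zero.2 hQR0, hQRt.lt_top, rfl⟩,
      h.inL1ClosureSpan hα hα1 hR.hasLpDensity⟩
  · obtain ⟨hgQ, hgQ0⟩ := RelAlpha.integrable_and_integral_eq_zero_of_mem_span hQ.2 hg
    have hfin := hform.relEntropy_lt_top hα hα1 hQ.1.hasLpDensity hR.hasLpDensity hgQ hgQ0
    have hpyth := fun P hP hPR => hform.relEntropy_add_le_and_eq (P := P) hα hα1 hR.hasLpDensity
      hQ hN hg hside hP hPR
    exact ⟨RelAlpha.isForwardProjection_unique_of_pythagoras hα hα1 (fun P hP => hP.1)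
      hR.hasLpDensity hQ hfin fun P hP hPR => (hpyth P hP hPR).1, hpyth⟩
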